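/- Let $A$ be a unital $C^*$-algebra and let $X$ be a compact Hausdorff space. A Hilbert $A$-module is a right $A$-module $V$ with a positive definite $A$-valued inner product (linear in the second variable) that is complete in the norm $\|\langle v,v\rangle\|^{1/2}$; $A^n$ carries $\langle a,b\rangle=\sum a_i^*b_i$, and $V$ is finitely generated projective (f.g.p.) if $V\oplus W\cong A^n$ isometrically for some $n$ and some Hilbert $A$-module $W$. $\mathrm{Hom}_A(V,V')$ denotes the adjointable $A$-linear bounded maps with the operator norm. A Hilbert $A$-module bundle over $X$ is a space $W\to X$ with Hilbert $A$-module fibers and local trivializations $W|_U\cong U\times V$ that are inner product preserving $A$-linear isomorphisms in each fiber; it is f.g.p. if its fibers are. An isomorphism of such bundles is a homeomorphism over $X$ which is fiberwise an invertible adjointable $A$-linear map; it is isometric if it preserves the inner products. If $X$ is a smooth manifold, a smooth structure on $W$ is an atlas of local trivializations whose transition functions $U_1\cap U_2\to \mathrm{Hom}_A(V_1,V_2)$ are smooth; a fiberwise map between smooth bundles is smooth if it is given by smooth $\mathrm{Hom}_A$-valued functions in the trivializations of the atlases, and an isomorphism is smooth if it and its inverse are. A projection valued function is a continuous $\varepsilon\colon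 X\to M(n\times n,A)$ with $\varepsilon=\varepsilon^2=\varepsilon^*$ pointwise; its image is $\{(x,v): v\in\operatorname{im}\varepsilon(x)\}\subset X\times A^n$, with the restricted topology and inner product. Then: 1. Every f.g.p. Hilbert $A$-module bundle $W$ over $X$ is isometrically isomorphic to an orthogonal direct summand $P$ of some trivial bundle $X\times A^n$: the fiberwise orthogonal complement $P^\perp$ is also an f.g.p. Hilbert $A$-module bundle, and $P\oplus P^\perp= X\times A^n$ as Hilbert $A$-module bundles. 2. Every such $W$ is isometrically isomorphic to the image of a projection valued function $\varepsilon\colon X\to M(n\times n,A)$ for some $n$. 3. Conversely, the image of every projection valued function is an f.g.p. Hilbert $A$-module bundle. 4. For every projection valued function $\varepsilon_1\colon X\to M(n\times n,A)$ there is $\delta>0$ such that for every projection valued function $\varepsilon_2\colon X\to M(n\times n,A)$ with $\|\varepsilon_1(x)-\varepsilon_2(x)\|<\delta$ for all $x\in X$ the two image bundles are isomorphic, and even isometrically so. Assume in addition that $X$ is a (finite dimensional) smooth manifold. 5. (a) If the projection valued function $\varepsilon$ is smooth, its image bundle inherits a canonical smooth structure from $X\times A^n$: there is one for which the inclusion into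 $X\times A^n$ and the projection $\varepsilon$ of $X\times A^n$ onto the image are smooth, and any other smooth structure with this property is equivalent to it (the identity is smooth in both directions). (b) If the f.g.p. bundle $W$ is smooth, then $\varepsilon$ in 2 can be chosen smooth, such that $W$ is isomorphic to the image bundle with its canonical smooth structure by a smooth isometric isomorphism. 6. Every f.g.p. Hilbert $A$-module bundle over $X$ admits a smooth structure. It is unique up to isomorphism: any two smooth f.g.p. Hilbert $A$-module bundles over $X$ which are isomorphic as topological bundles are isomorphic by a smooth isometric isomorphism. -/

import Mathlib

open scoped Manifold ContDiff
open MulOpposite WithCStarModule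

universe u v w w' uE uH

/-- The opposite of a C⋆-algebra, with the order transported from `A`, is again star-ordered. -/
instance mulOppositeStarOrderedRing (A : Type u) [CStarAlgebra A] [PartialOrder A]
    [StarOrderedRing A] : StarOrderedRing Aᵐᵒᵖ :=
  StarOrderedRing.of_nonneg_iff' (fun {x y} hxy z => add_le_add_right (α := A) hxy z.unop)
    (fun x => by
      have h : (0 : Aᵐᵒᵖ) ≤ x ↔ (0 : A) ≤ x.unop := Iff.rfl
      rw [h, CStarAlgebra.nonneg_iff_eq_star_mul_self]
      constructor
      · rintro ⟨b, hb⟩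
        have h0 : (0 : A) ≤ x.unop := by rw [hb]; exact star_mul_self_nonneg b
        obtain ⟨c, hc⟩ := CStarAlgebra.nonneg_iff_eq_mul_star_self.mp h0
        exact ⟨op c, by apply unop_injective; simpa using hc⟩
      · rintro ⟨s, rfl⟩
        exact ⟨star s.unop, by simp⟩)

/-- A (right) Hilbert `A`-module over a unital C⋆-algebra `A`. The right `A`-module structure is a
module structure over `Aᵐᵒᵖ`, and Mathlib's `CStarModule` (an inner product which is linear for a
*left* action in the second variable) is used over `Aᵐᵒᵖ`; see `HilbertModule.ip` for the resulting
`A`-valued inner product. Completeness is part of the structure. -/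
structure HilbertModule (A : Type u) [CStarAlgebra A] [PartialOrder A] [StarOrderedRing A] where
  carrier : Type w
  [normedAddCommGroup : NormedAddCommGroup carrier]
  [normedSpace : NormedSpace ℂ carrier]
  [completeSpace : CompleteSpace carrier]
  [module : Module Aᵐᵒᵖ carrier]
  [isScalarTower : IsScalarTower ℂ Aᵐᵒᵖ carrier]
  [cstarModule : CStarModule Aᵐᵒᵖ carrier]

namespace HilbertModule

variable {A : Type u} [CStarAlgebra A] [PartialOrder A] [StarOrderedRing A]

instance : CoeSort (HilbertModule.{u, w} A) (Type w) := ⟨HilbertModule.carrier⟩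

attribute [instance] normedAddCommGroup normedSpace completeSpace module isScalarTower cstarModule

/-- The `A`-valued inner product `⟨v₁, v₂⟩` of a right Hilbert `A`-module. -/
def ip (V : HilbertModule.{u, w} A) (v₁ v₂ : V) : A := unop (inner Aᵐᵒᵖ v₁ v₂)

theorem ip_smul_right (V : HilbertModule.{u, w} A) (v₁ v₂ : V) (a : A) :
    V.ip v₁ (op a • v₂) = V.ip v₁ v₂ * a := by
  simp [ip]

/-- An isomorphism of Hilbert modules which preserves the inner products. -/
structure IsometricIso (V : HilbertModule.{u, w} A) (W : HilbertModule.{u, w'} A) where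
  toLinearEquiv : V ≃ₗ[Aᵐᵒᵖ] W
  ip_map : ∀ v₁ v₂ : V, W.ip (toLinearEquiv v₁) (toLinearEquiv v₂) = V.ip v₁ v₂

/-- `Hom_A(V, W)`: the continuous `A`-linear maps which have an adjoint, as a subspace of the
bounded operators with the operator norm. -/
def Hom (V : HilbertModule.{u, w} A) (W : HilbertModule.{u, w'} A) :
    Submodule ℂ (V →L[ℂ] W) where
  carrier := {T | (∀ (a : A) (v : V), T (op a • v) = op a • T v) ∧
    ∃ S : W →L[ℂ] V, ∀ (v : V) (w : W), W.ip (T v) w = V.ip v (S w)}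
  zero_mem' := ⟨by simp, 0, by simp [ip]⟩
  add_mem' := by
    rintro T₁ T₂ ⟨h₁, S₁, hS₁⟩ ⟨h₂, S₂, hS₂⟩
    refine ⟨fun a v => by simp [h₁, h₂], S₁ + S₂, fun v w => ?_⟩
    have e₁ := hS₁ v w
    have e₂ := hS₂ v w
    simp only [ip] at e₁ e₂ ⊢
    simp [e₁, e₂]
  smul_mem' := by
    rintro c T ⟨h, S, hS⟩
    refine ⟨fun a v => ?_, star c • S, fun v w => ?_⟩
    · have h1 : ∀ x : W, c • (op a • x) = op a • (c • x) := fun x => by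
        rw [← smul_assoc, ← smul_one_smul Aᵐᵒᵖ c x, ← mul_smul]
        congr 1
        simp
      simp [h, h1]
    · have e := hS v w
      simp only [ip] at e ⊢
      simp [e]

/-- The Hilbert `A`-module `Aⁿ` with inner product `∑ aᵢ* bᵢ`. The coordinates are stored in `Aᵐᵒᵖ`,
on which `Aᵐᵒᵖ` acts from the left, i.e. `A` acts from the right; see `std_ip`. -/
noncomputable abbrev std (A : Type u) [CStarAlgebra A] [PartialOrder A] [StarOrderedRing A] (n : ℕ) :
    HilbertModule.{u, u} A where
  carrier := C⋆ᵐᵒᵈ(Aᵐᵒᵖ, Fin n → Aᵐᵒᵖ)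

theorem std_ip (n : ℕ) (x y : std A n) :
    (std A n).ip x y = ∑ i, star (x i).unop * (y i).unop := by
  change unop (∑ i, (y i * star (x i))) = _
  simp

/-- The orthogonal direct sum `V ⊕ W` with inner product `⟨v₁, v₂⟩ + ⟨w₁, w₂⟩`. -/
noncomputable abbrev prod (V : HilbertModule.{u, w} A) (W : HilbertModule.{u, w'} A) :
    HilbertModule.{u, max w w'} A where
  carrier := C⋆ᵐᵒᵈ(Aᵐᵒᵖ, V × W)

/-- The element `(v, w)` of `V ⊕ W`. -/
def prodMk (V : HilbertModule.{u, w} A) (W : HilbertModule.{u, w'} A) (v : V) (w : W) :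
    V.prod W := (WithCStarModule.equiv Aᵐᵒᵖ (V × W)).symm (v, w)

theorem prod_ip (V : HilbertModule.{u, w} A) (W : HilbertModule.{u, w'} A) (v₁ v₂ : V)
    (w₁ w₂ : W) : (V.prod W).ip (V.prodMk W v₁ w₁) (V.prodMk W v₂ w₂) = V.ip v₁ v₂ + W.ip w₁ w₂ :=
  rfl

/-- The components of an element of `V ⊕ W`. -/
def prodFst (V : HilbertModule.{u, w} A) (W : HilbertModule.{u, w'} A) (z : V.prod W) : V :=
  (WithCStarModule.equiv Aᵐᵒᵖ (V × W) z).1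

/-- The components of an element of `V ⊕ W`. -/
def prodSnd (V : HilbertModule.{u, w} A) (W : HilbertModule.{u, w'} A) (z : V.prod W) : W :=
  (WithCStarModule.equiv Aᵐᵒᵖ (V × W) z).2

/-- A closed submodule of a Hilbert module, with the restricted inner product. -/
noncomputable abbrev ofClosedSubmodule (V : HilbertModule.{u, w} A) (p : ClosedSubmodule Aᵐᵒᵖ V) :
    HilbertModule.{u, w} A where
  carrier := p.toSubmodule
  completeSpace := p.isClosed'.completeSpace_coe
  cstarModule :=
    { inner := fun x y => inner Aᵐᵒᵖ (x : V) (y : V)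
      inner_add_right := CStarModule.inner_add_right
      inner_self_nonneg := CStarModule.inner_self_nonneg
      inner_self := fun {x} => by
        rw [CStarModule.inner_self]
        exact Submodule.coe_eq_zero
      inner_op_smul_right := CStarModule.inner_op_smul_right
      inner_smul_right_complex := CStarModule.inner_smul_right_complex
      star_inner := fun x y => CStarModule.star_inner (x : V) (y : V)
      norm_eq_sqrt_norm_inner_self := fun x =>
        CStarModule.norm_eq_sqrt_norm_inner_self (A := Aᵐᵒᵖ) (x : V) }

/-- The inclusion of a closed submodule. -/
def inclusion (V : HilbertModule.{u, w} A) (p : ClosedSubmodule Aᵐᵒᵖ V) :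
    V.ofClosedSubmodule p → V := fun v => (show p.toSubmodule from v).1

/-- The orthogonal complement `{v | ⟨w, v⟩ = 0 for all w ∈ p}` of a submodule. -/
def orthogonal (V : HilbertModule.{u, w} A) (p : ClosedSubmodule Aᵐᵒᵖ V) :
    ClosedSubmodule Aᵐᵒᵖ V where
  carrier := {v | ∀ w ∈ p, V.ip w v = 0}
  zero_mem' := fun w _ => by simp [ip]
  add_mem' := fun {x y} hx hy w hw => by
    have e₁ := hx w hw
    have e₂ := hy w hw
    simp only [ip] at e₁ e₂ ⊢
    simp [e₁, e₂]
  smul_mem' := fun c x hx w hw => by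
    have e := hx w hw
    simp only [ip] at e ⊢
    simp [e]
  isClosed' := by
    have h : {v : V | ∀ w ∈ p, V.ip w v = 0} = ⋂ w : V, ⋂ _ : w ∈ p, {v : V | V.ip w v = 0} := by
      ext; simp
    change IsClosed {v : V | ∀ w ∈ p, V.ip w v = 0}
    rw [h]
    refine isClosed_iInter fun w => isClosed_iInter fun _ => ?_
    refine isClosed_eq ?_ continuous_const
    exact continuous_unop.comp ((CStarModule.continuous_inner (A := Aᵐᵒᵖ) (E := V)).comp
      (show Continuous (fun v : V => ((w, v) : V × V)) by fun_prop))

/-- `V` is finitely generated projective: an orthogonal direct summand of some `Aⁿ`. -/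
def IsFGP (V : HilbertModule.{u, w} A) : Prop :=
  ∃ (n : ℕ) (W : HilbertModule.{u, u} A), Nonempty (IsometricIso (V.prod W) (std A n))

/-- The action `v ↦ M v` of an `n × n`-matrix over `A` on the column vectors `Aⁿ`. -/
noncomputable def matrixAct {n : ℕ} (M : CStarMatrix (Fin n) (Fin n) A) :
    std A n →ₗ[Aᵐᵒᵖ] std A n where
  toFun v := (WithCStarModule.equiv Aᵐᵒᵖ (Fin n → Aᵐᵒᵖ)).symm fun i =>
    op (∑ j, M i j * unop (v j))
  map_add' x y := by
    apply (WithCStarModule.equiv Aᵐᵒᵖ (Fin n → Aᵐᵒᵖ)).injective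
    funext i
    change op (∑ j, M i j * (unop _ + unop _)) = op _ + op _
    rw [← op_add, ← Finset.sum_add_distrib]
    simp only [mul_add]
  map_smul' c x := by
    apply (WithCStarModule.equiv Aᵐᵒᵖ (Fin n → Aᵐᵒᵖ)).injective
    funext i
    change op (∑ j, M i j * (unop _ * unop c)) = c * op _
    apply unop_injective
    simp only [unop_mul, unop_op, Finset.sum_mul, mul_assoc]

theorem continuous_matrixAct {n : ℕ} (M : CStarMatrix (Fin n) (Fin n) A) :
    Continuous (matrixAct M) := by
  have h : Continuous (WithCStarModule.equiv Aᵐᵒᵖ (Fin n → Aᵐᵒᵖ)) := continuous_induced_dom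
  refine continuous_induced_rng.2 (continuous_pi fun i => continuous_op.comp
    (continuous_finsetSum _ fun j _ => continuous_const.mul
      (continuous_unop.comp ((continuous_apply j).comp h))))

theorem matrixAct_mul {n : ℕ} (M N : CStarMatrix (Fin n) (Fin n) A) (v : std A n) :
    matrixAct (M * N) v = matrixAct M (matrixAct N v) := by
  apply (WithCStarModule.equiv Aᵐᵒᵖ (Fin n → Aᵐᵒᵖ)).injective
  funext i
  change op (∑ j, (M * N) i j * unop _) = op (∑ j, M i j * ∑ k, N j k * unop _)
  congr 1
  simp only [CStarMatrix.mul_apply, Finset.sum_mul, Finset.mul_sum, mul_assoc]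
  exact Finset.sum_comm

/-- The image of a projection `M ∈ M(n × n, A)` acting on `Aⁿ`. -/
noncomputable def projImage {n : ℕ} (M : CStarMatrix (Fin n) (Fin n) A) (hM : IsStarProjection M) :
    ClosedSubmodule Aᵐᵒᵖ (std A n) where
  toSubmodule := LinearMap.range (matrixAct M)
  isClosed' := by
    have h : {v | matrixAct M v = v} = Set.range (matrixAct M) := by
      ext v
      constructor
      · exact fun hv => ⟨v, hv⟩
      · rintro ⟨u, rfl⟩
        change matrixAct M (matrixAct M u) = matrixAct M u
        rw [← matrixAct_mul, hM.isIdempotentElem.eq]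
    change IsClosed (Set.range (matrixAct M))
    rw [← h]
    exact isClosed_eq (continuous_matrixAct M) continuous_id

end HilbertModule

/-- The disjoint union of a family of Hilbert modules. -/
structure FiberTotal {A : Type u} [CStarAlgebra A] [PartialOrder A] [StarOrderedRing A]
    {X : Type v} (F : X → HilbertModule.{u, w} A) where
  base : X
  vec : F base

/-- A family of Hilbert `A`-modules over `X` together with a topology on the total space. Local
triviality is not included; see `HilbertModuleFamily.IsBundle`. -/
structure HilbertModuleFamily (A : Type u) [CStarAlgebra A] [PartialOrder A] [StarOrderedRing A]
    (X : Type v) where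
  fiber : X → HilbertModule.{u, w} A
  topology : TopologicalSpace (FiberTotal fiber)

namespace HilbertModuleFamily

variable {A : Type u} [CStarAlgebra A] [PartialOrder A] [StarOrderedRing A] {X : Type v}

/-- The total space. -/
abbrev Total (W : HilbertModuleFamily.{u, v, w} A X) : Type (max v w) := FiberTotal W.fiber

instance (W : HilbertModuleFamily.{u, v, w} A X) : TopologicalSpace W.Total := W.topology

/-- The bundle projection. -/
def proj (W : HilbertModuleFamily.{u, v, w} A X) : W.Total → X := FiberTotal.base

/-- The product family `X × V`. -/
def trivial (X : Type v) [TopologicalSpace X] (V : HilbertModule.{u, w} A) :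
    HilbertModuleFamily.{u, v, w} A X where
  fiber _ := V
  topology := TopologicalSpace.induced (fun p => ((p.base, p.vec) : X × V)) inferInstance

/-- The family of closed submodules `p x ≤ W_x`, with the subspace topology. -/
noncomputable def sub (W : HilbertModuleFamily.{u, v, w} A X)
    (p : ∀ x, ClosedSubmodule Aᵐᵒᵖ (W.fiber x)) : HilbertModuleFamily.{u, v, w} A X where
  fiber x := (W.fiber x).ofClosedSubmodule (p x)
  topology := TopologicalSpace.induced
    (fun q => (⟨q.base, (W.fiber q.base).inclusion (p q.base) q.vec⟩ : W.Total)) inferInstance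

/-- The fiberwise direct sum, with the topology of the fiber product `W₁ ×_X W₂ ⊆ W₁ × W₂`. -/
noncomputable def directSum (W₁ : HilbertModuleFamily.{u, v, w} A X)
    (W₂ : HilbertModuleFamily.{u, v, w'} A X) : HilbertModuleFamily.{u, v, max w w'} A X where
  fiber x := (W₁.fiber x).prod (W₂.fiber x)
  topology := TopologicalSpace.induced
    (fun q => ((⟨q.base, (W₁.fiber q.base).prodFst (W₂.fiber q.base) q.vec⟩,
      ⟨q.base, (W₁.fiber q.base).prodSnd (W₂.fiber q.base) q.vec⟩) : W₁.Total × W₂.Total))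
    inferInstance

/-- A local trivialization `W|_U ≅ U × V` (a homeomorphism over the open set `U`), which is an
isomorphism of Hilbert `A`-modules, including the inner product, in every fiber over `U`. -/
structure LocalTrivialization [TopologicalSpace X] (W : HilbertModuleFamily.{u, v, w} A X) where
  model : HilbertModule.{u, w} A
  triv : Bundle.Trivialization model W.proj
  isometric : ∀ x ∈ triv.baseSet, ∃ f : HilbertModule.IsometricIso (W.fiber x) model,
    ∀ v : W.fiber x, (triv ⟨x, v⟩).2 = f.toLinearEquiv v

/-- The fiber coordinate of a vector in a local trivialization. -/
def LocalTrivialization.coord [TopologicalSpace X] {W : HilbertModuleFamily.{u, v, w} A X}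
    (e : W.LocalTrivialization) (x : X) (v : W.fiber x) : e.model := (e.triv ⟨x, v⟩).2

/-- `W` is locally trivial, i.e. a Hilbert `A`-module bundle. -/
def IsBundle [TopologicalSpace X] (W : HilbertModuleFamily.{u, v, w} A X) : Prop :=
  ∀ x : X, ∃ e : W.LocalTrivialization, x ∈ e.triv.baseSet

/-- `W` is a finitely generated projective Hilbert `A`-module bundle. -/
def IsFGPBundle [TopologicalSpace X] (W : HilbertModuleFamily.{u, v, w} A X) : Prop :=
  W.IsBundle ∧ ∀ x : X, (W.fiber x).IsFGP

/-- An isomorphism of Hilbert `A`-module bundles over `X`: a homeomorphism of the total spaces over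
`X` which is an adjointable `A`-linear isomorphism in each fiber. It need not preserve the inner
products. -/
structure Iso (W₁ : HilbertModuleFamily.{u, v, w} A X)
    (W₂ : HilbertModuleFamily.{u, v, w'} A X) where
  fiberEquiv : ∀ x, W₁.fiber x ≃ₗ[Aᵐᵒᵖ] W₂.fiber x
  adjointable : ∀ x, ∃ S : W₂.fiber x → W₁.fiber x, ∀ (v : W₁.fiber x) (v' : W₂.fiber x),
    (W₂.fiber x).ip (fiberEquiv x v) v' = (W₁.fiber x).ip v (S v')
  continuous_toFun :
    Continuous fun q : W₁.Total => (⟨q.base, fiberEquiv q.base q.vec⟩ : W₂.Total)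
  continuous_invFun :
    Continuous fun q : W₂.Total => (⟨q.base, (fiberEquiv q.base).symm q.vec⟩ : W₁.Total)

/-- The isomorphism preserves the `A`-valued inner products. -/
def Iso.IsIsometric {W₁ : HilbertModuleFamily.{u, v, w} A X}
    {W₂ : HilbertModuleFamily.{u, v, w'} A X} (Φ : Iso W₁ W₂) : Prop :=
  ∀ (x : X) (v v' : W₁.fiber x),
    (W₂.fiber x).ip (Φ.fiberEquiv x v) (Φ.fiberEquiv x v') = (W₁.fiber x).ip v v'

/-- The closed submodules `p x ≤ T_x` and their orthogonal complements form finitely generated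
projective Hilbert `A`-module bundles `P` and `P^⊥` such that `P ⊕ P^⊥ = T`: addition is an
inner product preserving isomorphism of bundles. -/
def IsOrthogonalSummand [TopologicalSpace X] (T : HilbertModuleFamily.{u, v, w} A X)
    (p : ∀ x, ClosedSubmodule Aᵐᵒᵖ (T.fiber x)) : Prop :=
  (T.sub p).IsFGPBundle ∧ (T.sub fun x => (T.fiber x).orthogonal (p x)).IsFGPBundle ∧
  ∃ Ψ : Iso ((T.sub p).directSum (T.sub fun x => (T.fiber x).orthogonal (p x))) T,
    Ψ.IsIsometric ∧
    ∀ (x : X) (v : (T.fiber x).ofClosedSubmodule (p x))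
      (v' : (T.fiber x).ofClosedSubmodule ((T.fiber x).orthogonal (p x))),
      Ψ.fiberEquiv x (HilbertModule.prodMk _ _ v v') =
        (T.fiber x).inclusion _ v + (T.fiber x).inclusion _ v'

section Smooth

variable {E : Type*} [NormedAddCommGroup E] [NormedSpace ℝ E] {H : Type*} [TopologicalSpace H]
  (I : ModelWithCorners ℝ E H) [TopologicalSpace X] [ChartedSpace H X]

/-- In the local trivializations `e₁` and `e₂`, the fiberwise maps `f x` are given by a smooth
function with values in the normed space `Hom_A(V₁, V₂)` (on the common domain). -/
def SmoothInCoords {W₁ : HilbertModuleFamily.{u, v, w} A X}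
    {W₂ : HilbertModuleFamily.{u, v, w'} A X}
    (e₁ : W₁.LocalTrivialization) (e₂ : W₂.LocalTrivialization)
    (f : ∀ x, W₁.fiber x → W₂.fiber x) : Prop :=
  ∃ g : X → HilbertModule.Hom e₁.model e₂.model,
    ContMDiffOn I 𝓘(ℝ, HilbertModule.Hom e₁.model e₂.model) ∞ g
      (e₁.triv.baseSet ∩ e₂.triv.baseSet) ∧
    ∀ x ∈ e₁.triv.baseSet ∩ e₂.triv.baseSet, ∀ v : W₁.fiber x,
      (g x : e₁.model →L[ℂ] e₂.model) (e₁.coord x v) = e₂.coord x (f x v)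

/-- A smooth structure: an atlas of local trivializations with smooth transition functions. -/
structure SmoothStructure (W : HilbertModuleFamily.{u, v, w} A X) where
  atlas : Set W.LocalTrivialization
  exists_mem : ∀ x : X, ∃ e ∈ atlas, x ∈ e.triv.baseSet
  smooth_transition : ∀ e₁ ∈ atlas, ∀ e₂ ∈ atlas, SmoothInCoords I e₁ e₂ fun _ v => v

variable {I}

/-- A fiberwise map between smooth bundles is smooth. -/
def IsSmoothMap {W₁ : HilbertModuleFamily.{u, v, w} A X}
    {W₂ : HilbertModuleFamily.{u, v, w'} A X}
    (S₁ : SmoothStructure I W₁) (S₂ : SmoothStructure I W₂)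
    (f : ∀ x, W₁.fiber x → W₂.fiber x) : Prop :=
  ∀ e₁ ∈ S₁.atlas, ∀ e₂ ∈ S₂.atlas, SmoothInCoords I e₁ e₂ f

/-- The isomorphism and its inverse are smooth. -/
def Iso.IsSmooth {W₁ : HilbertModuleFamily.{u, v, w} A X}
    {W₂ : HilbertModuleFamily.{u, v, w'} A X} (Φ : Iso W₁ W₂)
    (S₁ : SmoothStructure I W₁) (S₂ : SmoothStructure I W₂) : Prop :=
  IsSmoothMap S₁ S₂ (fun x => Φ.fiberEquiv x) ∧
    IsSmoothMap S₂ S₁ (fun x => (Φ.fiberEquiv x).symm)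

/-- Two smooth structures on `W` define the same smooth bundle: the identity is smooth. -/
def SmoothStructure.Equivalent {W : HilbertModuleFamily.{u, v, w} A X}
    (S₁ S₂ : SmoothStructure I W) : Prop :=
  IsSmoothMap S₁ S₂ (fun _ v => v) ∧ IsSmoothMap S₂ S₁ (fun _ v => v)

end Smooth

/-- The global trivialization of the product family. -/
def trivialChart (X : Type v) [TopologicalSpace X] (V : HilbertModule.{u, w} A) :
    (trivial X V).LocalTrivialization where
  model := V
  triv :=
    { toFun := fun p => (p.base, p.vec)
      invFun := fun q => ⟨q.1, q.2⟩
      source := Set.univ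
      target := Set.univ
      map_source' := fun _ _ => Set.mem_univ _
      map_target' := fun _ _ => Set.mem_univ _
      left_inv' := fun _ _ => rfl
      right_inv' := fun _ _ => rfl
      open_source := isOpen_univ
      open_target := isOpen_univ
      continuousOn_toFun := (continuous_induced_dom).continuousOn
      continuousOn_invFun := (continuous_induced_rng.2 (show Continuous fun q : X × V => (q.1, q.2) from
        continuous_id)).continuousOn
      baseSet := Set.univ
      open_baseSet := isOpen_univ
      source_eq := rfl
      target_eq := by simp
      proj_toFun := fun _ _ => rfl }
  isometric := fun _ _ => ⟨⟨LinearEquiv.refl Aᵐᵒᵖ V, fun _ _ => rfl⟩, fun _ => rfl⟩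

/-- The product smooth structure on `X × V`. -/
def trivialSmooth {E : Type*} [NormedAddCommGroup E] [NormedSpace ℝ E] {H : Type*}
    [TopologicalSpace H] (I : ModelWithCorners ℝ E H) (X : Type v) [TopologicalSpace X]
    [ChartedSpace H X] (V : HilbertModule.{u, w} A) : SmoothStructure I (trivial X V) where
  atlas := {trivialChart X V}
  exists_mem := fun x => ⟨_, rfl, Set.mem_univ x⟩
  smooth_transition := by
    rintro _ rfl _ rfl
    refine ⟨fun _ => ⟨ContinuousLinearMap.id ℂ V, fun _ _ => rfl, ContinuousLinearMap.id ℂ V,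
      fun _ _ => rfl⟩, contMDiffOn_const, fun _ _ _ => rfl⟩

end HilbertModuleFamily

/-- A continuous function `X → M(n × n, A)` whose values are projections, `ε = ε² = ε*`. -/
structure ProjectionFunction (A : Type u) [CStarAlgebra A] [PartialOrder A] [StarOrderedRing A]
    (X : Type v) [TopologicalSpace X] (n : ℕ) where
  toFun : X → CStarMatrix (Fin n) (Fin n) A
  continuous_toFun : Continuous toFun
  isStarProjection : ∀ x, IsStarProjection (toFun x)

namespace ProjectionFunction

open HilbertModuleFamily

variable {A : Type u} [CStarAlgebra A] [PartialOrder A] [StarOrderedRing A] {X : Type v}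
  [TopologicalSpace X] {n : ℕ}

/-- The trivial bundle `X × Aⁿ`. -/
noncomputable abbrev ambient (A : Type u) [CStarAlgebra A] [PartialOrder A] [StarOrderedRing A]
    (X : Type v) [TopologicalSpace X] (n : ℕ) : HilbertModuleFamily.{u, v, u} A X :=
  HilbertModuleFamily.trivial X (HilbertModule.std A n)

/-- The fiberwise image `{(x, v) | v ∈ im ε(x)} ⊆ X × Aⁿ`. -/
noncomputable def image (ε : ProjectionFunction A X n) : HilbertModuleFamily.{u, v, u} A X :=
  (ambient A X n).sub fun x => HilbertModule.projImage (ε.toFun x) (ε.isStarProjection x)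

/-- The inclusion of the image family into `X × Aⁿ`. -/
noncomputable def incl (ε : ProjectionFunction A X n) (x : X) :
    ε.image.fiber x → (ambient A X n).fiber x :=
  (HilbertModule.std A n).inclusion
    (HilbertModule.projImage (ε.toFun x) (ε.isStarProjection x))

/-- The map `v ↦ ε(x) v` from `X × Aⁿ` onto the image family. -/
noncomputable def toImage (ε : ProjectionFunction A X n) (x : X) :
    (ambient A X n).fiber x → ε.image.fiber x :=
  fun v => (⟨HilbertModule.matrixAct (ε.toFun x) v, v, rfl⟩ :
    LinearMap.range (HilbertModule.matrixAct (ε.toFun x)))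

variable {E : Type*} [NormedAddCommGroup E] [NormedSpace ℝ E] {H : Type*} [TopologicalSpace H]
  {I : ModelWithCorners ℝ E H} [ChartedSpace H X]

/-- The smooth structure on the image family is inherited from `X × Aⁿ`: the inclusion into
`X × Aⁿ` and the projection `ε` from `X × Aⁿ` are smooth. -/
def IsInherited (ε : ProjectionFunction A X n) (S : SmoothStructure I ε.image) : Prop :=
  IsSmoothMap S (trivialSmooth I X (HilbertModule.std A n)) ε.incl ∧
    IsSmoothMap (trivialSmooth I X (HilbertModule.std A n)) S ε.toImage

end ProjectionFunction

/-!
The mechanism behind all six items is the *Parseval frame*: finitely many continuous sections of `W`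
which exhibit every fiber isometrically as the image of the projection `p x` in `M(n × n, A)` given
by the Gram matrix of the sections at `x`. Frames of a bundle over a compact base are glued from
local trivializations with a partition of unity whose squares sum to `1`, and smoothly so if the
bundle is smooth; a family with a frame is in turn a bundle, and it is smooth if the Gram matrix is.
Isometric isomorphisms between two framed bundles are then the same as continuous (smooth) functions
with values in the partial isometries from `p x` to `q x`, and every other assertion is about
projections and partial isometries in a C⋆-algebra.

The tool there is the polar part `z (z⋆ z)^(-1/2)`, a smooth function of `z`. Applied to `q p` it
provides the partial isometry between nearby projections, applied to a topological isomorphism it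
makes it isometric, and applied to a smooth approximation it makes a continuous partial isometry
smooth. A continuous projection valued function is smoothed in the same way, with the polar part of
the self-adjoint unit `2 a - 1` for a smooth `a` near it.
-/

section InverseSquareRoot

open Filter Topology

/-- Positive invertible elements of a C⋆-algebra, described by their spectrum so that no order on
the algebra is needed. -/
structure IsPositiveUnit {B : Type*} [CStarAlgebra B] (b : B) : Prop where
  isSelfAdjoint : IsSelfAdjoint b
  spectrum_pos : ∀ t ∈ spectrum ℝ b, 0 < t

/-- The inverse square root `b^(-1/2)`, by functional calculus. -/
noncomputable def invSqrt {B : Type*} [CStarAlgebra B] (b : B) : B :=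
  cfc (fun t : ℝ => (√t)⁻¹) b

theorem continuousOn_inv_sqrt : ContinuousOn (fun t : ℝ => (√t)⁻¹) (Set.Ioi 0) :=
  Real.continuous_sqrt.continuousOn.inv₀ fun _ ht => (Real.sqrt_pos.2 ht).ne'

variable {B : Type*} [CStarAlgebra B] {b : B}

theorem isSelfAdjoint_invSqrt (b : B) : IsSelfAdjoint (invSqrt b) := cfc_predicate _ _

theorem commute_invSqrt {c : B} (h : Commute b c) : Commute (invSqrt b) c := h.cfc_real _

theorem abs_sub_one_le_of_mem_spectrum {t : ℝ} (ht : t ∈ spectrum ℝ b) :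
    |t - 1| ≤ ‖b - 1‖ := by
  rcases subsingleton_or_nontrivial B with h | h
  · simp [spectrum.of_subsingleton] at ht
  have hmem : t - 1 ∈ spectrum ℝ (b - 1) := by
    rw [← map_one (algebraMap ℝ B), ← spectrum.sub_singleton_eq]
    exact Set.sub_mem_sub ht rfl
  simpa using spectrum.norm_le_norm_of_mem hmem

namespace IsPositiveUnit

theorem continuousOn_inv_sqrt_spectrum (hb : IsPositiveUnit b) :
    ContinuousOn (fun t : ℝ => (√t)⁻¹) (spectrum ℝ b) :=
  continuousOn_inv_sqrt.mono hb.spectrum_pos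

theorem invSqrt_mul_self_mul (hb : IsPositiveUnit b) : invSqrt b * invSqrt b * b = 1 := by
  have hc := hb.continuousOn_inv_sqrt_spectrum
  have hsa := hb.isSelfAdjoint
  calc invSqrt b * invSqrt b * b
    _ = cfc (fun t : ℝ => (√t)⁻¹ * (√t)⁻¹ * t) b := by
        rw [cfc_mul (fun t : ℝ => (√t)⁻¹ * (√t)⁻¹) (fun t => t) b (hc.mul hc) continuousOn_id,
          cfc_mul _ _ b hc hc, cfc_id' ℝ b, invSqrt]
    _ = cfc (1 : ℝ → ℝ) b := cfc_congr fun t ht => by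
        have ht0 := hb.spectrum_pos t ht
        simp only [← mul_inv, Real.mul_self_sqrt ht0.le, Pi.one_apply]
        exact inv_mul_cancel₀ ht0.ne'
    _ = 1 := cfc_one ℝ b

theorem invSqrt (hb : IsPositiveUnit b) : IsPositiveUnit (invSqrt b) where
  isSelfAdjoint := isSelfAdjoint_invSqrt b
  spectrum_pos t ht := by
    have hc := hb.continuousOn_inv_sqrt_spectrum
    have hsa := hb.isSelfAdjoint
    rw [_root_.invSqrt, cfc_map_spectrum (R := ℝ) _ b] at ht
    obtain ⟨s, hs, rfl⟩ := ht
    exact inv_pos.2 (Real.sqrt_pos.2 (hb.spectrum_pos s hs))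

theorem isUnit (hb : IsPositiveUnit b) : IsUnit b := by
  have hcomm : Commute (_root_.invSqrt b * _root_.invSqrt b) b :=
    (commute_invSqrt rfl).mul_left (commute_invSqrt rfl)
  exact ⟨⟨b, _, hcomm.eq.symm.trans hb.invSqrt_mul_self_mul, hb.invSqrt_mul_self_mul⟩, rfl⟩

theorem inverse_eq_invSqrt_mul_self (hb : IsPositiveUnit b) :
    Ring.inverse b = _root_.invSqrt b * _root_.invSqrt b := by
  obtain ⟨u, hu⟩ := hb.isUnit
  have hleft := hb.invSqrt_mul_self_mul
  rw [← hu] at hleft ⊢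
  rw [Ring.inverse_unit, ← Units.eq_inv_of_mul_eq_one_right hleft]

theorem norm_mul_invSqrt_sub_one_le (hb : IsPositiveUnit b) :
    ‖b * _root_.invSqrt b - 1‖ ≤ ‖b - 1‖ := by
  have hc := hb.continuousOn_inv_sqrt_spectrum
  have hsa := hb.isSelfAdjoint
  have hcfc : b * _root_.invSqrt b - 1 = cfc (fun t : ℝ => t * (√t)⁻¹ - 1) b := by
    rw [cfc_sub (fun t => t * (√t)⁻¹) _ b (continuousOn_id.mul hc) continuousOn_const,
      cfc_const_one ℝ b, cfc_mul (fun t => t) _ b continuousOn_id hc, cfc_id' ℝ b, _root_.invSqrt]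
  rw [hcfc]
  refine norm_cfc_le (norm_nonneg _) fun t ht => ?_
  refine le_trans ?_ (abs_sub_one_le_of_mem_spectrum ht)
  have hsqrt := Real.sqrt_pos.2 (hb.spectrum_pos t ht)
  have ht2 : t = √t * √t := (Real.mul_self_sqrt (hb.spectrum_pos t ht).le).symm
  have hfactor : t - 1 = (√t - 1) * (√t + 1) := by linear_combination ht2
  have hquot : t * (√t)⁻¹ = √t := by rw [← div_eq_mul_inv, Real.div_sqrt]
  rw [Real.norm_eq_abs, hquot, hfactor, abs_mul, abs_of_pos (by linarith : 0 < √t + 1)]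
  exact le_mul_of_one_le_right (abs_nonneg _) (by linarith)

theorem norm_norm_smul_one_sub_lt [Nontrivial B] (hb : IsPositiveUnit b) :
    ‖‖b‖ • (1 : B) - b‖ < ‖b‖ := by
  have hsa := hb.isSelfAdjoint
  have hb0 : 0 < ‖b‖ := norm_pos_iff.2 fun h => (hb.spectrum_pos 0 (by simp [h])).false
  have hcfc : ‖b‖ • (1 : B) - b = cfc (fun t : ℝ => ‖b‖ - t) b := by
    rw [cfc_sub _ (fun t => t) b continuousOn_const continuousOn_id, cfc_const _ b, cfc_id' ℝ b,
      Algebra.algebraMap_eq_smul_one]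
  rw [hcfc]
  refine norm_cfc_lt hb0 fun t ht => ?_
  have ht0 := hb.spectrum_pos t ht
  have htb : t ≤ ‖b‖ := (le_abs_self t).trans (spectrum.norm_le_norm_of_mem ht)
  rw [Real.norm_eq_abs, abs_of_nonneg (sub_nonneg.2 htb)]
  linarith

-- Divided by `2‖b‖`, the operator differs from `1` by the average of the left and the right
-- multiplication by `1 - b/‖b‖`, which has norm less than `1`.
theorem isUnit_mulLeft_add_mulRight (hb : IsPositiveUnit b) :
    IsUnit (ContinuousLinearMap.mul ℝ B b + (ContinuousLinearMap.mul ℝ B).flip b) := by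
  rcases subsingleton_or_nontrivial B with h | h
  · have : Subsingleton (B →L[ℝ] B) := ⟨fun f g => by ext; exact Subsingleton.elim _ _⟩
    exact isUnit_of_subsingleton _
  have hlt := hb.norm_norm_smul_one_sub_lt
  set c : ℝ := ‖b‖
  have hc₀ : 0 < c := (norm_nonneg _).trans_lt hlt
  have hc : 0 < 2 * c := by positivity
  set d : B := c • 1 - b with hd
  set T : B →L[ℝ] B := ContinuousLinearMap.mul ℝ B b + (ContinuousLinearMap.mul ℝ B).flip b
  have hdefect (y : B) : (1 - (2 * c)⁻¹ • T) y = (2 * c)⁻¹ • (d * y + y * d) := by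
    have hsum : d * y + y * d = (2 * c) • y - T y := by
      change _ = (2 * c) • y - (b * y + y * b)
      rw [hd, sub_mul, mul_sub, smul_mul_assoc, mul_smul_comm, one_mul, mul_one, two_mul, add_smul]
      abel
    rw [hsum, smul_sub, inv_smul_smul₀ hc.ne']
    rfl
  have hnorm : ‖1 - (2 * c)⁻¹ • T‖ < 1 := by
    refine (ContinuousLinearMap.opNorm_le_bound _ (M := ‖d‖ / c) (by positivity)
      fun y => ?_).trans_lt ((div_lt_one hc₀).2 hlt)
    have hle : ‖d * y + y * d‖ ≤ ‖d‖ * ‖y‖ + ‖y‖ * ‖d‖ :=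
      norm_add_le_of_le (norm_mul_le _ _) (norm_mul_le _ _)
    rw [hdefect, norm_smul, Real.norm_of_nonneg (by positivity), inv_mul_le_iff₀ hc]
    calc ‖d * y + y * d‖ ≤ 2 * (‖d‖ * ‖y‖) := by linarith
      _ = 2 * c * (‖d‖ / c * ‖y‖) := by field_simp
  have hunit : IsUnit ((2 * c)⁻¹ • T) := by
    simpa only [sub_sub_cancel] using isUnit_one_sub_of_norm_lt_one hnorm
  have hfactor : T = algebraMap ℝ (B →L[ℝ] B) (2 * c) * (2 * c)⁻¹ • T := by
    ext y
    exact (smul_inv_smul₀ hc.ne' (T y)).symm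
  rw [hfactor]
  exact (hc.ne'.isUnit.map _).mul hunit

-- Inverse function theorem: the derivative of `y ↦ y * y` at `b` is left plus right
-- multiplication by `b`.
theorem exists_contDiffAt_sqrt (hb : IsPositiveUnit b) :
    ∃ r : B → B, ContDiffAt ℝ ∞ r (b * b) ∧ ∀ᶠ y in 𝓝 b, r (y * y) = y := by
  obtain ⟨L, hL⟩ := hb.isUnit_mulLeft_add_mulRight
  have hsq : ContDiffAt ℝ ∞ (fun y : B => y * y) b := contDiffAt_id.mul contDiffAt_id
  have hderiv : HasFDerivAt (fun y : B => y * y)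
      (ContinuousLinearEquiv.ofUnit L : B →L[ℝ] B) b := by
    refine ((hasFDerivAt_id (𝕜 := ℝ) b).mul' (hasFDerivAt_id b)).congr_fderiv ?_
    ext y
    change _ = (L : B →L[ℝ] B) y
    simp [hL]
  exact ⟨_, hsq.to_localInverse hderiv (by simp),
    (hsq.hasStrictFDerivAt' hderiv (by simp)).eventually_left_inverse⟩

end IsPositiveUnit

theorem continuousOn_invSqrt : ContinuousOn (invSqrt : B → B) {b | IsPositiveUnit b} := by
  refine ContinuousOn.cfc_of_mem_nhdsSet (s := Set.Ioi 0) _ ?_ continuousOn_id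
    (fun _ hb => hb.isSelfAdjoint) continuousOn_inv_sqrt
  rw [isOpen_Ioi.mem_nhdsSet]
  exact Set.iUnion₂_subset fun _ hb => hb.spectrum_pos

theorem contDiffOn_invSqrt : ContDiffOn ℝ ∞ (invSqrt : B → B) {b | IsPositiveUnit b} := by
  intro b hb
  obtain ⟨r, hr, hrsq⟩ := hb.invSqrt.exists_contDiffAt_sqrt
  have hinv : ContDiffAt ℝ ∞ (Ring.inverse : B → B) b := by
    obtain ⟨u, rfl⟩ := hb.isUnit
    exact contDiffAt_ringInverse ℝ u
  rw [← hb.inverse_eq_invSqrt_mul_self] at hr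
  have hlocal : invSqrt =ᶠ[𝓝[{b | IsPositiveUnit b}] b] r ∘ Ring.inverse := by
    filter_upwards [continuousOn_invSqrt b hb hrsq, self_mem_nhdsWithin] with c hc hpos
    rw [Function.comp_apply, hpos.inverse_eq_invSqrt_mul_self]
    exact hc.symm
  exact (hr.comp b hinv).contDiffWithinAt.congr_of_eventuallyEq_of_mem hlocal hb

end InverseSquareRoot

section PolarDecomposition

variable {B : Type*} [CStarAlgebra B] {p q z t t' U : B}

/-- `U` is a partial isometry with initial projection `p` and final projection `q`. -/
structure IsPartialIsometryBetween (U p q : B) : Prop where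
  star_mul_self : star U * U = p
  mul_star_self : U * star U = q

namespace IsPartialIsometryBetween

theorem symm (hU : IsPartialIsometryBetween U p q) : IsPartialIsometryBetween (star U) q p :=
  ⟨by rw [star_star, hU.mul_star_self], by rw [star_star, hU.star_mul_self]⟩

theorem mul_initial (hU : IsPartialIsometryBetween U p q) (hp : IsStarProjection p) :
    U * p = U := by
  rw [← sub_eq_zero, ← CStarRing.star_mul_self_eq_zero_iff]
  have hexpand : star (U * p - U) * (U * p - U) =
      star p * (star U * U) * p - star p * (star U * U) - star U * U * p + star U * U := by
    rw [star_sub, star_mul]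
    noncomm_ring
  rw [hexpand, hU.star_mul_self, hp.isSelfAdjoint.star_eq, hp.isIdempotentElem.eq,
    hp.isIdempotentElem.eq]
  abel

theorem final_mul (hU : IsPartialIsometryBetween U p q) (hq : IsStarProjection q) :
    q * U = U := by
  apply star_injective
  rw [star_mul, hq.isSelfAdjoint.star_eq, hU.symm.mul_initial hq]

theorem norm_le_one (hU : IsPartialIsometryBetween U p q) (hp : IsStarProjection p) :
    ‖U‖ ≤ 1 := by
  have hsq := CStarRing.norm_star_mul_self (x := U)
  rw [hU.star_mul_self] at hsq
  nlinarith [hp.norm_le, norm_nonneg U]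

end IsPartialIsometryBetween

/-- The square of the modulus of `z`, completed by the identity off the range of `p` so that it is
invertible whenever `z` is invertible as a map out of the range of `p`. -/
def absSq (z p : B) : B := star z * z + (1 - p)

/-- The partial isometry in the polar decomposition of `z`, for `z` invertible as a map out of the
range of the projection `p`. -/
noncomputable def polar (z p : B) : B := z * invSqrt (absSq z p)

theorem absSq_sub_one (z p : B) : absSq z p - 1 = star z * z - p := by
  rw [absSq]
  abel

theorem isUnit_absSq_of_norm_lt (h : ‖star z * z - p‖ < 1) : IsUnit (absSq z p) := by
  rw [← absSq_sub_one, norm_sub_rev] at h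
  simpa only [sub_sub_cancel] using isUnit_one_sub_of_norm_lt_one h

theorem isPositiveUnit_absSq (hp : IsStarProjection p) (h : IsUnit (absSq z p)) :
    IsPositiveUnit (absSq z p) where
  isSelfAdjoint := (IsSelfAdjoint.star_mul_self z).add ((IsSelfAdjoint.one B).sub hp.isSelfAdjoint)
  spectrum_pos t ht := by
    let _ := CStarAlgebra.spectralOrder B
    let _ := CStarAlgebra.spectralOrderedRing B
    have hnonneg : 0 ≤ absSq z p := add_nonneg (star_mul_self_nonneg z) hp.one_sub_nonneg
    refine (spectrum_nonneg_of_nonneg hnonneg ht).lt_of_ne ?_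
    rintro rfl
    exact (spectrum.zero_mem_iff ℝ).1 ht h

theorem absSq_mul (hp : IsStarProjection p) (hzp : z * p = z) : absSq z p * p = star z * z := by
  rw [absSq, add_mul, mul_assoc, hzp, hp.one_sub_mul_self, add_zero]

theorem mul_absSq (hp : IsStarProjection p) (hzp : z * p = z) : p * absSq z p = star z * z := by
  have hpz : p * star z = star z := by
    rw [← hp.isSelfAdjoint.star_eq, ← star_mul, hzp]
  rw [absSq, mul_add, ← mul_assoc, hpz, hp.mul_one_sub_self, add_zero]

theorem commute_invSqrt_absSq (hp : IsStarProjection p) (hzp : z * p = z) :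
    Commute (invSqrt (absSq z p)) p :=
  commute_invSqrt ((absSq_mul hp hzp).trans (mul_absSq hp hzp).symm)

theorem star_polar_mul_polar (hp : IsStarProjection p) (hzp : z * p = z)
    (h : IsUnit (absSq z p)) : star (polar z p) * polar z p = p := by
  have hinv := (isPositiveUnit_absSq hp h).invSqrt_mul_self_mul
  have hcomm : Commute (invSqrt (absSq z p)) (absSq z p) := commute_invSqrt rfl
  have hcommp := commute_invSqrt_absSq hp hzp
  have habs := absSq_mul hp hzp
  rw [polar, star_mul, (isSelfAdjoint_invSqrt _).star_eq]
  set b := absSq z p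
  set R := invSqrt b
  calc R * star z * (z * R) = R * (b * p) * R := by rw [habs]; noncomm_ring
    _ = R * b * (p * R) := by noncomm_ring
    _ = R * (b * R) * p := by rw [← hcommp.eq]; noncomm_ring
    _ = p := by rw [← hcomm.eq, ← mul_assoc, hinv, one_mul]

theorem polar_mul_star_polar_mul (hp : IsStarProjection p) (hzp : z * p = z)
    (h : IsUnit (absSq z p)) : polar z p * star (polar z p) * z = z := by
  have hinv := (isPositiveUnit_absSq hp h).invSqrt_mul_self_mul
  have habs := absSq_mul hp hzp
  rw [polar, star_mul, (isSelfAdjoint_invSqrt _).star_eq]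
  set b := absSq z p
  set R := invSqrt b
  calc z * R * (R * star z) * z = z * (R * R * (b * p)) := by rw [habs]; noncomm_ring
    _ = z * (R * R * b * p) := by rw [mul_assoc _ b p]
    _ = z := by rw [hinv, one_mul, hzp]

/-- The element `z` restricts to an invertible map from the range of `p` to the range of `q`;
invertibility is expressed by the completed moduli of `z` and of its adjoint. -/
structure IsInvertibleBetween (z p q : B) : Prop where
  mul_initial : z * p = z
  final_mul : q * z = z
  isUnit_absSq : IsUnit (absSq z p)
  isUnit_absSq_star : IsUnit (absSq (star z) q)

theorem IsInvertibleBetween.polar (hz : IsInvertibleBetween z p q) (hp : IsStarProjection p)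
    (hq : IsStarProjection q) : IsPartialIsometryBetween (polar z p) p q where
  star_mul_self := star_polar_mul_polar hp hz.mul_initial hz.isUnit_absSq
  mul_star_self := by
    set f := _root_.polar z p * star (_root_.polar z p) with hf
    have hfz : f * z = z := polar_mul_star_polar_mul hp hz.mul_initial hz.isUnit_absSq
    have hzq : star z * q = star z := by
      rw [← hq.isSelfAdjoint.star_eq, ← star_mul, hz.final_mul]
    have hfq : f * q = f := by
      rw [hf, _root_.polar, star_mul]
      simp only [mul_assoc, hzq]
    have hzero : (q - f) * absSq (star z) q = 0 := by
      rw [absSq, star_star]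
      calc (q - f) * (z * star z + (1 - q))
          = (q * z - f * z) * star z + (q - q * q) - (f - f * q) := by noncomm_ring
        _ = 0 := by
          rw [hz.final_mul, hfz, hfq, hq.isIdempotentElem.eq]
          simp only [sub_self, zero_mul, add_zero]
    exact (sub_eq_zero.1 ((hz.isUnit_absSq_star.mul_left_eq_zero).1 hzero)).symm

theorem IsInvertibleBetween.of_norm_lt (hzp : z * p = z) (hqz : q * z = z)
    (hp : ‖star z * z - p‖ < 1) (hq : ‖z * star z - q‖ < 1) : IsInvertibleBetween z p q :=
  ⟨hzp, hqz, isUnit_absSq_of_norm_lt hp, isUnit_absSq_of_norm_lt (by rwa [star_star])⟩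

/-- `t` and `t'` are mutually inverse maps between the ranges of `p` and `q`. -/
structure IsInverseBetween (t t' p q : B) : Prop where
  mul_initial : t * p = t
  inv_mul_final : t' * q = t'
  inv_mul_self : t' * t = p
  mul_inv_self : t * t' = q

namespace IsInverseBetween

theorem final_mul (h : IsInverseBetween t t' p q) : q * t = t := by
  rw [← h.mul_inv_self, mul_assoc, h.inv_mul_self, h.mul_initial]

theorem symm (h : IsInverseBetween t t' p q) : IsInverseBetween t' t q p :=
  ⟨h.inv_mul_final, h.mul_initial, h.mul_inv_self, h.inv_mul_self⟩

theorem star (h : IsInverseBetween t t' p q) (hp : IsStarProjection p) (hq : IsStarProjection q) :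
    IsInverseBetween (star t) (star t') q p where
  mul_initial := by rw [← hq.isSelfAdjoint.star_eq, ← star_mul, h.final_mul]
  inv_mul_final := by rw [← hp.isSelfAdjoint.star_eq, ← star_mul, h.symm.final_mul]
  inv_mul_self := by rw [← star_mul, h.mul_inv_self, hq.isSelfAdjoint.star_eq]
  mul_inv_self := by rw [← star_mul, h.inv_mul_self, hp.isSelfAdjoint.star_eq]

theorem isUnit_absSq (h : IsInverseBetween t t' p q) (hp : IsStarProjection p)
    (hq : IsStarProjection q) : IsUnit (absSq t p) := by
  have hright : absSq t p * (t' * Star.star t' + (1 - p)) = 1 := by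
    calc absSq t p * (t' * Star.star t' + (1 - p))
        = Star.star t * (t * t') * Star.star t' + Star.star t * (t - t * p)
          + (t' - p * t') * Star.star t' + (1 - p - (p - p * p)) := by rw [absSq]; noncomm_ring
      _ = 1 := by
        rw [h.mul_inv_self, h.mul_initial, h.symm.final_mul, (h.star hp hq).mul_initial,
          (h.star hp hq).mul_inv_self, hp.isIdempotentElem.eq]
        simp only [sub_self, mul_zero, zero_mul, add_zero, sub_zero, add_sub_cancel]
  have hleft : (t' * Star.star t' + (1 - p)) * absSq t p = 1 := by
    simpa [absSq, hp.isSelfAdjoint.star_eq] using congrArg Star.star hright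
  exact ⟨⟨_, _, hright, hleft⟩, rfl⟩

theorem isInvertibleBetween (h : IsInverseBetween t t' p q) (hp : IsStarProjection p)
    (hq : IsStarProjection q) : IsInvertibleBetween t p q :=
  ⟨h.mul_initial, h.final_mul, h.isUnit_absSq hp hq, (h.star hp hq).isUnit_absSq hq hp⟩

end IsInverseBetween

theorem star_polar_sub_mul_polar_sub (hp : IsStarProjection p) (hzp : z * p = z)
    (h : IsUnit (absSq z p)) : star (polar z p - z) * (polar z p - z) =
      (absSq z p * invSqrt (absSq z p) - 1) * (absSq z p * invSqrt (absSq z p) - 1) * p := by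
  have hinv := (isPositiveUnit_absSq hp h).invSqrt_mul_self_mul
  have hcomm : Commute (invSqrt (absSq z p)) (absSq z p) := commute_invSqrt rfl
  have hcommp := commute_invSqrt_absSq hp hzp
  have habs := absSq_mul hp hzp
  rw [polar, star_sub, star_mul, (isSelfAdjoint_invSqrt _).star_eq]
  set b := absSq z p
  set R := invSqrt b
  have hRbR : R * b * R = 1 := by rw [mul_assoc, ← hcomm.eq, ← mul_assoc, hinv]
  calc (R * star z - star z) * (z * R - z) = (R - 1) * (b * p) * (R - 1) := by
        rw [habs]; noncomm_ring
    _ = (R - 1) * b * (p * R - p) := by noncomm_ring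
    _ = (R * b * R - R * b - b * R + b) * p := by rw [← hcommp.eq]; noncomm_ring
    _ = (b * (R * b * R) - b * R - b * R + 1) * p := by rw [hRbR, hcomm.eq]; noncomm_ring
    _ = (b * R - 1) * (b * R - 1) * p := by noncomm_ring

theorem norm_polar_sub_le (hp : IsStarProjection p) (hzp : z * p = z) (h : IsUnit (absSq z p)) :
    ‖polar z p - z‖ ≤ ‖star z * z - p‖ := by
  rw [← absSq_sub_one]
  refine le_trans ?_ (isPositiveUnit_absSq hp h).norm_mul_invSqrt_sub_one_le
  set c := absSq z p * invSqrt (absSq z p) - 1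
  refine le_of_sq_le_sq ?_ (norm_nonneg c)
  calc ‖polar z p - z‖ ^ 2 = ‖c * c * p‖ := by
        rw [sq, ← CStarRing.norm_star_mul_self, star_polar_sub_mul_polar_sub hp hzp h]
    _ ≤ ‖c‖ * ‖c‖ * ‖p‖ := norm_mul₃_le
    _ ≤ ‖c‖ ^ 2 := by
      rw [← sq]
      exact mul_le_of_le_one_right (sq_nonneg _) hp.norm_le

theorem contDiffOn_polar : ContDiffOn ℝ ∞ (fun x : B × B => polar x.1 x.2)
    {x | IsStarProjection x.2 ∧ IsUnit (absSq x.1 x.2)} := by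
  have hstar : ContDiff ℝ ∞ fun x : B × B => star x.1 :=
    (starL' ℝ : B ≃L[ℝ] B).contDiff.comp contDiff_fst
  have habsSq : ContDiff ℝ ∞ fun x : B × B => absSq x.1 x.2 :=
    (hstar.mul contDiff_fst).add (contDiff_const.sub contDiff_snd)
  exact contDiff_fst.contDiffOn.mul
    (contDiffOn_invSqrt.comp habsSq.contDiffOn fun x hx => isPositiveUnit_absSq hx.1 hx.2)

theorem continuous_polar {Y : Type*} [TopologicalSpace Y] {f g : Y → B} (hf : Continuous f)
    (hg : Continuous g) (h : ∀ y, IsStarProjection (g y) ∧ IsUnit (absSq (f y) (g y))) :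
    Continuous fun y => polar (f y) (g y) :=
  contDiffOn_polar.continuousOn.comp_continuous (hf.prodMk hg) h

/-- A partial isometry from the range of `p` onto the range of `q`, if `p` and `q` are close. -/
noncomputable def align (p q : B) : B := polar (q * p) p

theorem norm_star_mul_self_sub_le (hp : IsStarProjection p) (hq : IsStarProjection q) :
    ‖star (q * p) * (q * p) - p‖ ≤ ‖p - q‖ := by
  have hcompress : star (q * p) * (q * p) - p = p * (q - p) * p := by
    have hpp := hp.isIdempotentElem.eq
    rw [star_mul, hp.isSelfAdjoint.star_eq, hq.isSelfAdjoint.star_eq]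
    calc p * q * (q * p) - p = p * (q * q) * p - p := by noncomm_ring
      _ = p * q * p - p * p * p := by rw [hq.isIdempotentElem.eq, hpp, hpp]
      _ = p * (q - p) * p := by noncomm_ring
  calc ‖star (q * p) * (q * p) - p‖ ≤ ‖p‖ * ‖q - p‖ * ‖p‖ := by rw [hcompress]; exact norm_mul₃_le
    _ ≤ 1 * ‖q - p‖ * 1 := by gcongr <;> exact hp.norm_le
    _ = ‖p - q‖ := by rw [one_mul, mul_one, norm_sub_rev]

theorem isPartialIsometryBetween_align (hp : IsStarProjection p) (hq : IsStarProjection q)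
    (h : ‖p - q‖ < 1) : IsPartialIsometryBetween (align p q) p q := by
  have hfinal := norm_star_mul_self_sub_le hq hp
  rw [norm_sub_rev q p] at hfinal
  have hstar : star (p * q) = q * p := by
    rw [star_mul, hp.isSelfAdjoint.star_eq, hq.isSelfAdjoint.star_eq]
  rw [← star_star (p * q), hstar, star_star] at hfinal
  exact (IsInvertibleBetween.of_norm_lt (by rw [mul_assoc, hp.isIdempotentElem.eq])
    (by rw [← mul_assoc, hq.isIdempotentElem.eq]) ((norm_star_mul_self_sub_le hp hq).trans_lt h)
    (hfinal.trans_lt h)).polar hp hq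

theorem contDiffOn_align : ContDiffOn ℝ ∞ (fun x : B × B => align x.1 x.2)
    {x | IsStarProjection x.1 ∧ IsStarProjection x.2 ∧ ‖x.1 - x.2‖ < 1} := by
  have hpair : ContDiff ℝ ∞ fun x : B × B => (x.2 * x.1, x.1) :=
    (contDiff_snd.mul contDiff_fst).prodMk contDiff_fst
  refine contDiffOn_polar.comp hpair.contDiffOn ?_
  rintro ⟨p, q⟩ ⟨hp, hq, h⟩
  exact ⟨hp, isUnit_absSq_of_norm_lt ((norm_star_mul_self_sub_le hp hq).trans_lt h)⟩

theorem continuousOn_align {Y : Type*} [TopologicalSpace Y] {f g : Y → B} {s : Set Y}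
    (hf : ContinuousOn f s) (hg : ContinuousOn g s)
    (h : ∀ y ∈ s, IsStarProjection (f y) ∧ IsStarProjection (g y) ∧ ‖f y - g y‖ < 1) :
    ContinuousOn (fun y => align (f y) (g y)) s :=
  contDiffOn_align.continuousOn.comp (hf.prodMk hg) h

end PolarDecomposition

section SmoothApproximation

section Perturbation

variable {B : Type*} [CStarAlgebra B] {z U p q v : B}

theorem norm_star_mul_self_sub_star_mul_self_le (hU : ‖U‖ ≤ 1) (hz : ‖z - U‖ ≤ 1) :
    ‖star z * z - star U * U‖ ≤ 3 * ‖z - U‖ := by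
  have hz2 : ‖z‖ ≤ 2 := by linarith [norm_sub_norm_le z U]
  calc ‖star z * z - star U * U‖ = ‖star z * (z - U) + star (z - U) * U‖ := by
        rw [star_sub]; noncomm_ring
    _ ≤ ‖star z‖ * ‖z - U‖ + ‖star (z - U)‖ * ‖U‖ :=
        (norm_add_le _ _).trans (add_le_add (norm_mul_le _ _) (norm_mul_le _ _))
    _ ≤ 2 * ‖z - U‖ + ‖z - U‖ * 1 := by rw [norm_star, norm_star]; gcongr
    _ = 3 * ‖z - U‖ := by ring

namespace IsPartialIsometryBetween

theorem norm_compress_sub_le (hU : IsPartialIsometryBetween U p q) (hp : IsStarProjection p)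
    (hq : IsStarProjection q) (z : B) : ‖q * z * p - U‖ ≤ ‖z - U‖ :=
  calc ‖q * z * p - U‖ = ‖q * (z - U) * p‖ := by
        rw [mul_sub, sub_mul, hU.final_mul hq, hU.mul_initial hp]
    _ ≤ ‖q‖ * ‖z - U‖ * ‖p‖ := norm_mul₃_le
    _ ≤ 1 * ‖z - U‖ * 1 := by gcongr; exacts [hq.norm_le, hp.norm_le]
    _ = ‖z - U‖ := by rw [one_mul, mul_one]

theorem norm_star_mul_self_sub_le (hU : IsPartialIsometryBetween U p q) (hp : IsStarProjection p)
    (hz : ‖z - U‖ < 1 / 3) : ‖star z * z - p‖ ≤ 3 * ‖z - U‖ := by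
  rw [← hU.star_mul_self]
  exact norm_star_mul_self_sub_star_mul_self_le (hU.norm_le_one hp) (by linarith)

theorem isUnit_absSq (hU : IsPartialIsometryBetween U p q) (hp : IsStarProjection p)
    (hz : ‖z - U‖ < 1 / 3) : IsUnit (absSq z p) :=
  isUnit_absSq_of_norm_lt (by linarith [hU.norm_star_mul_self_sub_le hp hz])

theorem isInvertibleBetween_compress (hU : IsPartialIsometryBetween U p q)
    (hp : IsStarProjection p) (hq : IsStarProjection q) (hz : ‖z - U‖ < 1 / 3) :
    IsInvertibleBetween (q * z * p) p q := by
  have hclose : ‖q * z * p - U‖ < 1 / 3 := (hU.norm_compress_sub_le hp hq z).trans_lt hz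
  have hclose' : ‖star (q * z * p) - star U‖ < 1 / 3 := by rwa [← star_sub, norm_star]
  exact ⟨by rw [mul_assoc, hp.isIdempotentElem.eq],
    by rw [← mul_assoc, ← mul_assoc, hq.isIdempotentElem.eq],
    hU.isUnit_absSq hp hclose, hU.symm.isUnit_absSq hq hclose'⟩

end IsPartialIsometryBetween

theorem isSelfAdjoint_polar_one (hz : IsSelfAdjoint z) : IsSelfAdjoint (polar z 1) := by
  have hcomm : Commute (absSq z 1) z := by
    rw [absSq, sub_self, add_zero, hz.star_eq]
    exact (Commute.refl z).mul_left (Commute.refl z)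
  rw [IsSelfAdjoint, polar, star_mul, (isSelfAdjoint_invSqrt _).star_eq, hz.star_eq,
    (commute_invSqrt hcomm).eq]

theorem isStarProjection_half_one_add (hv : IsSelfAdjoint v) (hvv : v * v = 1) :
    IsStarProjection ((1 / 2 : ℝ) • (1 + v)) where
  isIdempotentElem := by
    have hsq : (1 + v) * (1 + v) = (2 : ℝ) • (1 + v) := by
      rw [two_smul]
      calc (1 + v) * (1 + v) = 1 + v + (v + v * v) := by noncomm_ring
        _ = 1 + v + (1 + v) := by rw [hvv, add_comm v 1]
    rw [IsIdempotentElem, smul_mul_smul_comm, hsq, smul_smul]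
    norm_num
  isSelfAdjoint := (IsSelfAdjoint.all _).smul ((IsSelfAdjoint.one B).add hv)

theorem isPartialIsometryBetween_two_mul_sub_one (hp : IsStarProjection p) :
    IsPartialIsometryBetween (2 * p - 1) 1 1 :=
  let hunitary := Unitary.mem_iff.1 hp.two_mul_sub_one_mem_unitary
  ⟨hunitary.1, hunitary.2⟩

/-- The projections `p` correspond to the self-adjoint unitaries `2 * p - 1`, and polar
decomposition turns any self-adjoint element near the latter into a self-adjoint unitary. -/
theorem isStarProjection_half_one_add_polar (hz : IsSelfAdjoint z) (hp : IsStarProjection p)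
    (h : ‖z - (2 * p - 1)‖ < 1 / 3) :
    IsStarProjection ((1 / 2 : ℝ) • (1 + polar z 1)) ∧
      ‖(1 / 2 : ℝ) • (1 + polar z 1) - p‖ ≤ 2 * ‖z - (2 * p - 1)‖ := by
  set t := 2 * p - 1 with ht
  have htU : IsPartialIsometryBetween t 1 1 := isPartialIsometryBetween_two_mul_sub_one hp
  have hone := IsStarProjection.one B
  have hzt := htU.norm_star_mul_self_sub_le hone h
  have hunit : IsUnit (absSq z 1) := htU.isUnit_absSq hone h
  have hsa := isSelfAdjoint_polar_one hz
  refine ⟨isStarProjection_half_one_add hsa ?_, ?_⟩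
  · simpa only [hsa.star_eq] using star_polar_mul_polar hone (mul_one z) hunit
  · have hpt : p = (1 / 2 : ℝ) • (1 + t) := by
      rw [ht, add_sub_cancel, two_mul, ← two_smul ℝ p, smul_smul]
      norm_num
    calc ‖(1 / 2 : ℝ) • (1 + polar z 1) - p‖ = 1 / 2 * ‖polar z 1 - z + (z - t)‖ := by
          conv_lhs => rw [hpt]
          rw [← smul_sub, norm_smul, add_sub_add_left_eq_sub, sub_add_sub_cancel,
            Real.norm_of_nonneg (by norm_num)]
      _ ≤ 1 / 2 * (3 * ‖z - t‖ + ‖z - t‖) := by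
          gcongr
          exact (norm_add_le _ _).trans
            (add_le_add_left ((norm_polar_sub_le hone (mul_one z) hunit).trans hzt) _)
      _ = 2 * ‖z - t‖ := by ring

end Perturbation

variable {E : Type*} [NormedAddCommGroup E] [NormedSpace ℝ E]
  {H : Type*} [TopologicalSpace H] {I : ModelWithCorners ℝ E H} {X : Type*} [TopologicalSpace X]
  [ChartedSpace H X] {B : Type*} [CStarAlgebra B]

theorem contMDiff_polar {z p : X → B} (hz : ContMDiff I 𝓘(ℝ, B) ∞ z)
    (hp : ContMDiff I 𝓘(ℝ, B) ∞ p)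
    (h : ∀ x, IsStarProjection (p x) ∧ IsUnit (absSq (z x) (p x))) :
    ContMDiff I 𝓘(ℝ, B) ∞ fun x => polar (z x) (p x) :=
  contMDiffOn_univ.1
    (contDiffOn_polar.contMDiffOn.comp (hz.prodMk_space hp).contMDiffOn fun x _ => h x)

theorem contMDiffOn_align {f g : X → B} {s : Set X} (hf : ContMDiffOn I 𝓘(ℝ, B) ∞ f s)
    (hg : ContMDiffOn I 𝓘(ℝ, B) ∞ g s)
    (h : ∀ x ∈ s, IsStarProjection (f x) ∧ IsStarProjection (g x) ∧ ‖f x - g x‖ < 1) :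
    ContMDiffOn I 𝓘(ℝ, B) ∞ (fun x => align (f x) (g x)) s :=
  contDiffOn_align.contMDiffOn.comp (hf.prodMk_space hg) h

theorem contMDiffAt_star {f : X → B} {x : X} (hf : ContMDiffAt I 𝓘(ℝ, B) ∞ f x) :
    ContMDiffAt I 𝓘(ℝ, B) ∞ (fun x => star (f x)) x :=
  (starL' ℝ : B ≃L[ℝ] B).contDiff.contMDiff.contMDiffAt.comp x hf

theorem contMDiff_mul_of_normedAlgebra {R : Type*} [NormedRing R] [NormedAlgebra ℝ R]
    {f g : X → R} (hf : ContMDiff I 𝓘(ℝ, R) ∞ f) (hg : ContMDiff I 𝓘(ℝ, R) ∞ g) :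
    ContMDiff I 𝓘(ℝ, R) ∞ fun x => f x * g x :=
  contDiff_mul.contMDiff.comp (hf.prodMk_space hg)

variable [FiniteDimensional ℝ E] [IsManifold I ∞ X] [SigmaCompactSpace X] [T2Space X]

theorem exists_contMDiff_mem_convex_norm_sub_lt {F : Type*} [NormedAddCommGroup F]
    [NormedSpace ℝ F] {C : Set F} (hC : Convex ℝ C) {f : X → F} (hf : Continuous f)
    (hfC : ∀ x, f x ∈ C) {η : ℝ} (hη : 0 < η) :
    ∃ g : X → F, ContMDiff I 𝓘(ℝ, F) ∞ g ∧ ∀ x, g x ∈ C ∧ ‖g x - f x‖ < η := by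
  obtain ⟨g, hg⟩ := exists_contMDiffMap_forall_mem_convex_of_local_const I (n := ⊤)
    (t := fun x => C ∩ Metric.ball (f x) η) (fun x => hC.inter (convex_ball _ _)) fun x =>
      ⟨f x, by
        filter_upwards [hf.continuousAt.eventually (Metric.ball_mem_nhds (f x) hη)] with y hy
        exact ⟨hfC x, Metric.mem_ball_comm.1 hy⟩⟩
  exact ⟨g, g.contMDiff, fun x => ⟨(hg x).1, mem_ball_iff_norm.1 (hg x).2⟩⟩

theorem exists_contMDiff_isStarProjection {e : X → B} (he : Continuous e)
    (hproj : ∀ x, IsStarProjection (e x)) {δ : ℝ} (hδ : 0 < δ) :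
    ∃ p : X → B, ContMDiff I 𝓘(ℝ, B) ∞ p ∧ (∀ x, IsStarProjection (p x)) ∧
      ∀ x, ‖p x - e x‖ < δ := by
  have hsymmetry x : 2 * e x - 1 ∈ selfAdjoint.submodule ℝ B := by
    rw [two_mul]
    exact ((hproj x).isSelfAdjoint.add (hproj x).isSelfAdjoint).sub (.one B)
  obtain ⟨s, hs, hsnear⟩ := exists_contMDiff_mem_convex_norm_sub_lt (I := I)
    (selfAdjoint.submodule ℝ B).convex (by fun_prop : Continuous fun x => 2 * e x - 1) hsymmetry
    (η := min (1 / 3) (δ / 2)) (by positivity)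
  have hthird x : ‖s x - (2 * e x - 1)‖ < 1 / 3 := (hsnear x).2.trans_le (min_le_left _ _)
  have hp x := isStarProjection_half_one_add_polar (hsnear x).1 (hproj x) (hthird x)
  have hunit x : IsUnit (absSq (s x) 1) :=
    (isPartialIsometryBetween_two_mul_sub_one (hproj x)).isUnit_absSq (.one B) (hthird x)
  refine ⟨fun x => (1 / 2 : ℝ) • (1 + polar (s x) 1), ?_, fun x => (hp x).1, fun x => ?_⟩
  · have hpolar : ContMDiff I 𝓘(ℝ, B) ∞ fun x => polar (s x) 1 :=
      contMDiff_polar hs contMDiff_const fun x => ⟨.one B, hunit x⟩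
    exact (contDiff_const_smul (1 / 2 : ℝ)).contMDiff.comp (contMDiff_const.add hpolar)
  · have hhalf : ‖s x - (2 * e x - 1)‖ < δ / 2 := (hsnear x).2.trans_le (min_le_right _ _)
    linarith [(hp x).2]

theorem exists_contMDiff_isPartialIsometryBetween {U p q : X → B} (hU : Continuous U)
    (hp : ContMDiff I 𝓘(ℝ, B) ∞ p) (hq : ContMDiff I 𝓘(ℝ, B) ∞ q)
    (hproj : ∀ x, IsStarProjection (p x) ∧ IsStarProjection (q x))
    (hpartial : ∀ x, IsPartialIsometryBetween (U x) (p x) (q x)) :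
    ∃ V : X → B, ContMDiff I 𝓘(ℝ, B) ∞ V ∧
      ∀ x, IsPartialIsometryBetween (V x) (p x) (q x) := by
  obtain ⟨z, hz, hzU⟩ := exists_contMDiff_mem_convex_norm_sub_lt (I := I) convex_univ hU
    (fun x => Set.mem_univ (U x)) (η := 1 / 3) (by norm_num)
  have hinv x : IsInvertibleBetween (q x * z x * p x) (p x) (q x) :=
    (hpartial x).isInvertibleBetween_compress (hproj x).1 (hproj x).2 (hzU x).2
  exact ⟨fun x => polar (q x * z x * p x) (p x),
    contMDiff_polar
      (contMDiff_mul_of_normedAlgebra (contMDiff_mul_of_normedAlgebra hq hz) hp) hp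
      fun x => ⟨(hproj x).1, (hinv x).isUnit_absSq⟩,
    fun x => (hinv x).polar (hproj x).1 (hproj x).2⟩

end SmoothApproximation

universe w₁ w₂ w₃

theorem contDiff_of_map_add_smul {E F : Type*} [NormedAddCommGroup E]
    [NormedSpace ℝ E] [NormedAddCommGroup F] [NormedSpace ℝ F] {f : E → F} (hf : Continuous f)
    (hadd : ∀ x y, f (x + y) = f x + f y) (hsmul : ∀ (r : ℝ) (x : E), f (r • x) = r • f x) :
    ContDiff ℝ ∞ f :=
  (⟨⟨⟨f, hadd⟩, hsmul⟩, hf⟩ : E →L[ℝ] F).contDiff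

namespace HilbertModule

variable {A : Type u} [CStarAlgebra A] [PartialOrder A] [StarOrderedRing A]

section InnerProduct

variable (V : HilbertModule.{u, w} A)

theorem star_ip (x y : V) : star (V.ip x y) = V.ip y x :=
  congrArg unop (CStarModule.star_inner (A := Aᵐᵒᵖ) x y)

theorem ip_add_left (x y z : V) : V.ip (x + y) z = V.ip x z + V.ip y z :=
  congrArg unop CStarModule.inner_add_left

theorem ip_sub_left (x y z : V) : V.ip (x - y) z = V.ip x z - V.ip y z :=
  congrArg unop CStarModule.inner_sub_left

theorem ip_zero_right (x : V) : V.ip x 0 = 0 :=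
  congrArg unop CStarModule.inner_zero_right

theorem ip_op_smul_left (x y : V) (a : Aᵐᵒᵖ) : V.ip (a • x) y = star (unop a) * V.ip x y := by
  rw [← star_ip, ← op_unop a, ip_smul_right, star_mul, star_ip, unop_op]

theorem ip_real_smul_right (x y : V) (c : ℝ) : V.ip x (c • y) = c • V.ip x y :=
  congrArg unop (CStarModule.inner_smul_right_real (A := Aᵐᵒᵖ))

theorem ip_real_smul_left (x y : V) (c : ℝ) : V.ip (c • x) y = c • V.ip x y :=
  congrArg unop (CStarModule.inner_smul_left_real (A := Aᵐᵒᵖ))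

theorem ip_sum_right {ι : Type*} (s : Finset ι) (x : V) (y : ι → V) :
    V.ip x (∑ i ∈ s, y i) = ∑ i ∈ s, V.ip x (y i) := by
  simp only [ip, CStarModule.inner_sum_right, Finset.unop_sum]

theorem ip_sum_left {ι : Type*} (s : Finset ι) (x : ι → V) (y : V) :
    V.ip (∑ i ∈ s, x i) y = ∑ i ∈ s, V.ip (x i) y := by
  simp only [ip, CStarModule.inner_sum_left, Finset.unop_sum]

theorem eq_zero_of_ip_self_eq_zero {x : V} (h : V.ip x x = 0) : x = 0 :=
  CStarModule.inner_self.1 (unop_injective h : inner Aᵐᵒᵖ x x = 0)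

theorem ext_ip {x y : V} (h : ∀ z, V.ip x z = V.ip y z) : x = y :=
  sub_eq_zero.1 (V.eq_zero_of_ip_self_eq_zero (by rw [ip_sub_left, h, sub_self]))

theorem continuous_ip : Continuous fun p : V × V => V.ip p.1 p.2 :=
  continuous_unop.comp (CStarModule.continuous_inner (A := Aᵐᵒᵖ) (E := V))

end InnerProduct

section Adjoint

variable {U : HilbertModule.{u, w₁} A} {V : HilbertModule.{u, w₂} A} {W : HilbertModule.{u, w₃} A}

/-- `g` is adjoint to `f`. No linearity or continuity is required, since both are automatic; see
`IsAdjoint.toHom`. -/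
def IsAdjoint (f : V → W) (g : W → V) : Prop := ∀ v w, W.ip (f v) w = V.ip v (g w)

namespace IsAdjoint

variable {f : V → W} {g : W → V}

theorem symm (h : IsAdjoint f g) : IsAdjoint g f := fun w v => by
  rw [← V.star_ip, ← h, W.star_ip]

theorem comp (h : IsAdjoint f g) {f' : U → V} {g' : V → U} (h' : IsAdjoint f' g') :
    IsAdjoint (f ∘ f') (g' ∘ g) := fun _ _ => (h _ _).trans (h' _ _)

/-- A map with an adjoint as a linear map. -/
def toLinearMap (h : IsAdjoint f g) : V →ₗ[Aᵐᵒᵖ] W where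
  toFun := f
  map_add' x y := W.ext_ip fun z => by rw [h, V.ip_add_left, W.ip_add_left, h, h]
  map_smul' a x := W.ext_ip fun z => by
    rw [h, V.ip_op_smul_left, RingHom.id_apply, W.ip_op_smul_left, h]

theorem continuous (h : IsAdjoint f g) : Continuous f := by
  let L : V →ₗ[ℂ] W := h.toLinearMap.restrictScalars ℂ
  have hgraph : (L.graph : Set (V × W)) = ⋂ z : W, {p : V × W | W.ip p.2 z = V.ip p.1 (g z)} := by
    ext p
    simp only [SetLike.mem_coe, LinearMap.mem_graph_iff, Set.mem_iInter, Set.mem_ofPred_eq]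
    exact ⟨fun hp z => hp ▸ h _ _, fun hp => W.ext_ip fun z => (hp z).trans (h _ _).symm⟩
  refine L.continuous_of_isClosed_graph (hgraph ▸ isClosed_iInter fun z => isClosed_eq ?_ ?_)
  · exact W.continuous_ip.comp (continuous_snd.prodMk continuous_const)
  · exact V.continuous_ip.comp (continuous_fst.prodMk continuous_const)

theorem map_real_smul (h : IsAdjoint f g) (c : ℝ) (v : V) : f (c • v) = c • f v :=
  W.ext_ip fun z => by rw [h, V.ip_real_smul_left, W.ip_real_smul_left, h]

theorem map_zero (h : IsAdjoint f g) : f 0 = 0 := h.toLinearMap.map_zero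

theorem map_sum (h : IsAdjoint f g) {ι : Type*} (s : Finset ι) (v : ι → V) :
    f (∑ i ∈ s, v i) = ∑ i ∈ s, f (v i) := _root_.map_sum h.toLinearMap v s

/-- A map with an adjoint as an element of `Hom_A(V, W)`. -/
def toHom (h : IsAdjoint f g) : Hom V W :=
  ⟨⟨h.toLinearMap.restrictScalars ℂ, h.continuous⟩, fun a => h.toLinearMap.map_smul (op a),
    ⟨h.symm.toLinearMap.restrictScalars ℂ, h.symm.continuous⟩, h⟩

/-- A map whose adjoint is its inverse as an isometric isomorphism. -/
def isometricIso (h : IsAdjoint f g) (hgf : ∀ v, g (f v) = v) (hfg : ∀ w, f (g w) = w) :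
    IsometricIso V W where
  toLinearEquiv := { h.toLinearMap with invFun := g, left_inv := hgf, right_inv := hfg }
  ip_map v v' := (h v (f v')).trans (congrArg (V.ip v) (hgf v'))

end IsAdjoint

namespace Hom

theorem ext {T S : Hom V W} (h : ∀ v, T.1 v = S.1 v) : T = S :=
  Subtype.ext (ContinuousLinearMap.ext h)

/-- Composition of adjointable maps. -/
def comp (T : Hom V W) (S : Hom U V) : Hom U W :=
  ⟨T.1.comp S.1, fun a v => by simp only [ContinuousLinearMap.comp_apply, S.2.1, T.2.1], by
    obtain ⟨T', hT⟩ := T.2.2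
    obtain ⟨S', hS⟩ := S.2.2
    exact ⟨S'.comp T', fun v w => (hT _ _).trans (hS _ _)⟩⟩

theorem isBoundedBilinearMap_comp :
    IsBoundedBilinearMap ℝ fun p : Hom V W × Hom U V => comp p.1 p.2 where
  add_left _ _ _ := ext fun _ => rfl
  smul_left _ _ _ := ext fun _ => rfl
  add_right T _ _ := ext fun _ => map_add T.1 _ _
  smul_right c T S := ext fun x => (T.1.restrictScalars ℝ).map_smul c (S.1 x)
  bound := ⟨1, one_pos, fun T S => by
    rw [one_mul]
    exact ContinuousLinearMap.opNorm_comp_le T.1 S.1⟩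

theorem contMDiffAt_comp {E : Type*} [NormedAddCommGroup E] [NormedSpace ℝ E] {H : Type*}
    [TopologicalSpace H] {I : ModelWithCorners ℝ E H} {X : Type*} [TopologicalSpace X]
    [ChartedSpace H X] {T : X → Hom V W} {S : X → Hom U V} {x : X}
    (hT : ContMDiffAt I 𝓘(ℝ, Hom V W) ∞ T x) (hS : ContMDiffAt I 𝓘(ℝ, Hom U V) ∞ S x) :
    ContMDiffAt I 𝓘(ℝ, Hom U W) ∞ (fun x => comp (T x) (S x)) x :=
  have hcomp : ContDiff ℝ ∞ fun p : Hom V W × Hom U V => comp p.1 p.2 :=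
    isBoundedBilinearMap_comp.contDiff
  hcomp.contMDiff.contMDiffAt.comp x (hT.prodMk_space hS)

end Hom

namespace IsometricIso

/-- The inverse isomorphism. -/
def symm (f : IsometricIso V W) : IsometricIso W V where
  toLinearEquiv := f.toLinearEquiv.symm
  ip_map v₁ v₂ := by
    rw [← f.ip_map, LinearEquiv.apply_symm_apply, LinearEquiv.apply_symm_apply]

theorem isAdjoint (f : IsometricIso V W) : IsAdjoint f.toLinearEquiv f.toLinearEquiv.symm :=
  fun v w => by rw [← f.ip_map, LinearEquiv.apply_symm_apply]

end IsometricIso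

end Adjoint

section Matrix

variable {n : ℕ}

theorem continuous_std_apply (i : Fin n) : Continuous fun v : std A n => v i :=
  (continuous_apply i).comp
    (continuous_induced_dom : Continuous (WithCStarModule.equiv Aᵐᵒᵖ (Fin n → Aᵐᵒᵖ)))

theorem std_ext {v w : std A n} (h : ∀ i, v i = w i) : v = w := WithCStarModule.ext (A := Aᵐᵒᵖ) h

theorem matrixAct_apply (M : CStarMatrix (Fin n) (Fin n) A) (v : std A n) (i : Fin n) :
    matrixAct M v i = op (∑ j, M i j * unop (v j)) := rfl

theorem matrixAct_one (v : std A n) : matrixAct (1 : CStarMatrix (Fin n) (Fin n) A) v = v := by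
  refine std_ext fun i => ?_
  rw [matrixAct_apply, Finset.sum_eq_single i (fun j _ hj => by
    rw [CStarMatrix.one_apply_ne' hj, zero_mul]) (fun hi => absurd (Finset.mem_univ i) hi),
    CStarMatrix.one_apply_eq, one_mul, op_unop]

theorem matrixAct_add (M N : CStarMatrix (Fin n) (Fin n) A) (v : std A n) :
    matrixAct (M + N) v = matrixAct M v + matrixAct N v := by
  refine std_ext fun i => ?_
  rw [WithCStarModule.add_apply]
  change op (∑ j, (M i j + N i j) * unop (v j)) =
    op (∑ j, M i j * unop (v j)) + op (∑ j, N i j * unop (v j))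
  simp only [← op_add, ← Finset.sum_add_distrib, add_mul]

theorem matrixAct_real_smul (c : ℝ) (M : CStarMatrix (Fin n) (Fin n) A) (v : std A n) :
    matrixAct (c • M) v = c • matrixAct M v := by
  refine std_ext fun i => ?_
  rw [WithCStarModule.smul_apply]
  change op (∑ j, (c • M i j) * unop (v j)) = c • op (∑ j, M i j * unop (v j))
  simp only [← op_smul, Finset.smul_sum, smul_mul_assoc]

theorem isAdjoint_matrixAct (M : CStarMatrix (Fin n) (Fin n) A) :
    IsAdjoint (matrixAct M) (matrixAct (star M)) := fun v w => by
  rw [std_ip, std_ip]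
  change ∑ i, star (∑ j, M i j * unop (v j)) * unop (w i) =
    ∑ i, star (unop (v i)) * ∑ j, star (M j i) * unop (w j)
  simp only [star_sum, Finset.sum_mul, Finset.mul_sum, star_mul, mul_assoc]
  exact Finset.sum_comm

theorem norm_matrixAct_le (M : CStarMatrix (Fin n) (Fin n) A) (v : std A n) :
    ‖matrixAct M v‖ ≤ (n * n : ℝ) * ‖M‖ * ‖v‖ := by
  have hentry i j : ‖M i j * unop (v j)‖ ≤ ‖M‖ * ‖v‖ := by
    refine (norm_mul_le _ _).trans ?_
    gcongr
    · exact CStarMatrix.norm_entry_le_norm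
    · rw [MulOpposite.norm_unop]
      exact WithCStarModule.norm_apply_le_norm v j
  calc ‖matrixAct M v‖ ≤ ∑ i, ‖matrixAct M v i‖ := WithCStarModule.pi_norm_le_sum_norm _
    _ ≤ ∑ _i : Fin n, ∑ _j : Fin n, ‖M‖ * ‖v‖ := by
      refine Finset.sum_le_sum fun i _ => ?_
      rw [matrixAct_apply, MulOpposite.norm_op]
      exact norm_sum_le_of_le _ fun j _ => hentry i j
    _ = (n * n : ℝ) * ‖M‖ * ‖v‖ := by
      rw [Fin.sum_const, Fin.sum_const, nsmul_eq_mul, nsmul_eq_mul]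
      ring

/-- The action of matrices on `Aⁿ` as a bounded operator from matrices to `Hom_A(Aⁿ, Aⁿ)`. -/
noncomputable def matrixHom (A : Type u) [CStarAlgebra A] [PartialOrder A] [StarOrderedRing A]
    (n : ℕ) : CStarMatrix (Fin n) (Fin n) A →L[ℝ] Hom (std A n) (std A n) :=
  LinearMap.mkContinuous
    { toFun := fun M => (isAdjoint_matrixAct M).toHom
      map_add' := fun M N => Hom.ext fun v => matrixAct_add M N v
      map_smul' := fun c M => Hom.ext fun v => matrixAct_real_smul c M v } (n * n : ℝ)
    fun M => ContinuousLinearMap.opNorm_le_bound (isAdjoint_matrixAct M).toHom.1 (by positivity)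
      (norm_matrixAct_le M)

theorem continuous_matrixAct_uncurry :
    Continuous fun p : CStarMatrix (Fin n) (Fin n) A × std A n => matrixAct p.1 p.2 :=
  have hHom : Continuous fun p : CStarMatrix (Fin n) (Fin n) A × std A n => (matrixHom A n p.1).1 :=
    continuous_subtype_val.comp ((matrixHom A n).continuous.comp continuous_fst)
  hHom.clm_apply continuous_snd

/-- The standard basis vectors of `Aⁿ`. -/
noncomputable def stdBasis (n : ℕ) (j : Fin n) : std A n :=
  (WithCStarModule.equiv Aᵐᵒᵖ (Fin n → Aᵐᵒᵖ)).symm (Pi.single j 1)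

theorem stdBasis_apply (i j : Fin n) :
    stdBasis (A := A) n j i = (Pi.single j 1 : Fin n → Aᵐᵒᵖ) i := rfl

theorem sum_apply_std {ι : Type*} (s : Finset ι) (f : ι → std A n) (i : Fin n) :
    (∑ k ∈ s, f k) i = ∑ k ∈ s, f k i := Finset.sum_apply i s f

theorem sum_smul_stdBasis (v : std A n) : ∑ j, v j • stdBasis n j = v := by
  refine std_ext fun i => ?_
  rw [sum_apply_std, Finset.sum_eq_single i (fun j _ hj => by
    rw [WithCStarModule.smul_apply, stdBasis_apply, Pi.single_eq_of_ne hj.symm, smul_zero])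
    (fun hi => absurd (Finset.mem_univ i) hi), WithCStarModule.smul_apply, stdBasis_apply,
    Pi.single_eq_same, smul_eq_mul, mul_one]

/-- The matrix of an `A`-linear map of `Aⁿ`. -/
noncomputable def toMatrix (L : std A n → std A n) : CStarMatrix (Fin n) (Fin n) A :=
  CStarMatrix.ofMatrix fun i j => unop (L (stdBasis n j) i)

theorem matrixAct_toMatrix (L : std A n →ₗ[Aᵐᵒᵖ] std A n) (v : std A n) :
    matrixAct (toMatrix L) v = L v := by
  conv_rhs => rw [← sum_smul_stdBasis v, map_sum]
  refine std_ext fun i => ?_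
  rw [sum_apply_std, matrixAct_apply, Finset.op_sum]
  refine Finset.sum_congr rfl fun j _ => ?_
  rw [map_smul]
  rfl

theorem toMatrix_matrixAct (M : CStarMatrix (Fin n) (Fin n) A) : toMatrix (matrixAct M) = M := by
  refine CStarMatrix.ext fun i j => ?_
  change unop (matrixAct M (stdBasis n j) i) = M i j
  rw [matrixAct_apply, unop_op, Finset.sum_eq_single j (fun k _ hk => by
    rw [stdBasis_apply, Pi.single_eq_of_ne hk, unop_zero, mul_zero])
    (fun hj => absurd (Finset.mem_univ j) hj), stdBasis_apply, Pi.single_eq_same, unop_one, mul_one]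

theorem matrix_ext {M N : CStarMatrix (Fin n) (Fin n) A}
    (h : ∀ v, matrixAct M v = matrixAct N v) : M = N := by
  rw [← toMatrix_matrixAct M, ← toMatrix_matrixAct N, funext h]

theorem continuous_toMatrix {Y : Type*} [TopologicalSpace Y] {L : Y → std A n → std A n}
    (h : ∀ v, Continuous fun y => L y v) : Continuous fun y => toMatrix (L y) :=
  continuous_pi fun i => continuous_pi fun _ =>
    continuous_unop.comp ((continuous_std_apply i).comp (h _))

theorem contDiff_toMatrix : ContDiff ℝ ∞ fun T : Hom (std A n) (std A n) => toMatrix T.1 :=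
  contDiff_of_map_add_smul
    (continuous_toMatrix fun v =>
      (ContinuousLinearMap.apply ℂ (std A n) v).continuous.comp continuous_subtype_val)
    (fun _ _ => rfl) fun _ _ => rfl

theorem contDiff_matrixHom : ContDiff ℝ ∞ (matrixHom A n) :=
  contDiff_of_map_add_smul (matrixHom A n).continuous (map_add _) (map_smul _)

end Matrix

end HilbertModule

section Cutoff

open Filter Topology

variable {X : Type*} [TopologicalSpace X] {r : X → ℝ}

theorem continuousAt_smul_of_mem_tsupport {Y F : Type*} [TopologicalSpace Y]
    [NormedAddCommGroup F] [NormedSpace ℝ F] {b : Y → X} {g : Y → F} {y : Y} (hr : Continuous r)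
    (hb : ContinuousAt b y) (hg : b y ∈ tsupport r → ContinuousAt g y) :
    ContinuousAt (fun z => r (b z) • g z) y := by
  by_cases hy : b y ∈ tsupport r
  · exact (hr.continuousAt.comp hb).smul (hg hy)
  · refine continuousAt_const.congr (f := fun _ => (0 : F)) ?_
    filter_upwards [hb.eventually (notMem_tsupport_iff_eventuallyEq.1 hy)] with z hz
    rw [hz, Pi.zero_apply, zero_smul]

end Cutoff

namespace HilbertModuleFamily

open HilbertModule Filter Topology

variable {A : Type u} [CStarAlgebra A] [PartialOrder A] [StarOrderedRing A] {X : Type v}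
  [TopologicalSpace X]

namespace LocalTrivialization

variable {W : HilbertModuleFamily.{u, v, w} A X} (e : W.LocalTrivialization)

/-- The isomorphism of the fiber over a point of the base set with the model. -/
noncomputable def fiberIso {x : X} (hx : x ∈ e.triv.baseSet) : IsometricIso (W.fiber x) e.model :=
  (e.isometric x hx).choose

theorem fiberIso_apply {x : X} (hx : x ∈ e.triv.baseSet) (v : W.fiber x) :
    (e.fiberIso hx).toLinearEquiv v = e.coord x v :=
  ((e.isometric x hx).choose_spec v).symm

open Classical in
/-- The inverse of the fiber coordinate, extended by zero outside the base set. -/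
noncomputable def symmCoord (x : X) (m : e.model) : W.fiber x :=
  if hx : x ∈ e.triv.baseSet then (e.fiberIso hx).toLinearEquiv.symm m else 0

theorem symmCoord_eq {x : X} (hx : x ∈ e.triv.baseSet) (m : e.model) :
    e.symmCoord x m = (e.fiberIso hx).toLinearEquiv.symm m := dif_pos hx

theorem coord_symmCoord {x : X} (hx : x ∈ e.triv.baseSet) (m : e.model) :
    e.coord x (e.symmCoord x m) = m := by
  rw [symmCoord_eq e hx, ← fiberIso_apply e hx, LinearEquiv.apply_symm_apply]

theorem symmCoord_coord {x : X} (hx : x ∈ e.triv.baseSet) (v : W.fiber x) :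
    e.symmCoord x (e.coord x v) = v := by
  rw [symmCoord_eq e hx, ← fiberIso_apply e hx, LinearEquiv.symm_apply_apply]

theorem isAdjoint_coord {x : X} (hx : x ∈ e.triv.baseSet) :
    IsAdjoint (e.coord x) (e.symmCoord x) := fun v m => by
  rw [symmCoord_eq e hx, ← e.fiberIso_apply hx, (e.fiberIso hx).isAdjoint]

theorem triv_apply {q : W.Total} (hq : q.base ∈ e.triv.baseSet) :
    e.triv q = (q.base, e.coord q.base q.vec) :=
  Prod.ext (e.triv.coe_fst (e.triv.mem_source.2 hq)) rfl

variable {Y : Type*} [TopologicalSpace Y] {y : Y}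

theorem continuousAt_coord {f : Y → W.Total} (hf : ContinuousAt f y)
    (hy : (f y).base ∈ e.triv.baseSet) :
    ContinuousAt (fun z => e.coord (f z).base (f z).vec) y :=
  (continuous_snd.continuousAt.comp
    (e.triv.toOpenPartialHomeomorph.continuousAt (e.triv.mem_source.2 hy))).comp hf

theorem continuousAt_total {f : Y → W.Total} (hb : ContinuousAt (fun z => (f z).base) y)
    (hy : (f y).base ∈ e.triv.baseSet)
    (hf : ContinuousAt (fun z => e.coord (f z).base (f z).vec) y) : ContinuousAt f y := by
  have hbase : ∀ᶠ z in 𝓝 y, (f z).base ∈ e.triv.baseSet :=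
    hb.eventually (e.triv.open_baseSet.mem_nhds hy)
  rw [e.triv.toOpenPartialHomeomorph.continuousAt_iff_continuousAt_comp_left
    (hbase.mono fun z hz => e.triv.mem_source.2 hz)]
  exact (hb.prodMk hf).congr (hbase.mono fun z hz => (e.triv_apply hz).symm)

theorem continuousAt_symmCoord {b : Y → X} {f : Y → e.model} (hb : ContinuousAt b y)
    (hy : b y ∈ e.triv.baseSet) (hf : ContinuousAt f y) :
    ContinuousAt (fun z => (⟨b z, e.symmCoord (b z) (f z)⟩ : W.Total)) y := by
  refine e.continuousAt_total hb hy (hf.congr ?_)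
  filter_upwards [hb.eventually (e.triv.open_baseSet.mem_nhds hy)] with z hz
  exact (e.coord_symmCoord hz _).symm

end LocalTrivialization

theorem IsBundle.continuous_proj {W : HilbertModuleFamily.{u, v, w} A X} (hW : W.IsBundle) :
    Continuous W.proj := continuous_iff_continuousAt.2 fun q =>
  have ⟨e, he⟩ := hW q.base
  e.triv.continuousAt_proj (e.triv.mem_source.2 he)

section Smooth

variable {E : Type*} [NormedAddCommGroup E] [NormedSpace ℝ E] {H : Type*} [TopologicalSpace H]
  {I : ModelWithCorners ℝ E H} [ChartedSpace H X]
  {W₁ : HilbertModuleFamily.{u, v, w₁} A X} {W₂ : HilbertModuleFamily.{u, v, w₂} A X}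
  {W₃ : HilbertModuleFamily.{u, v, w₃} A X}
  {e₁ : W₁.LocalTrivialization} {e₂ : W₂.LocalTrivialization} {e₃ : W₃.LocalTrivialization}
  {f : ∀ x, W₁.fiber x → W₂.fiber x} {x : X}

variable (I) in
/-- The local version of `SmoothInCoords`: near `x` the fiberwise maps `f` are given
in the local trivializations `e₁` and `e₂` by a function with values in `Hom_A(V₁, V₂)` which is
smooth at `x`. -/
def SmoothInCoordsAt (e₁ : W₁.LocalTrivialization) (e₂ : W₂.LocalTrivialization)
    (f : ∀ x, W₁.fiber x → W₂.fiber x) (x : X) : Prop :=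
  ∃ g : X → Hom e₁.model e₂.model, ContMDiffAt I 𝓘(ℝ, Hom e₁.model e₂.model) ∞ g x ∧
    ∀ᶠ y in 𝓝 x, ∀ v : W₁.fiber y, (g y).1 (e₁.coord y v) = e₂.coord y (f y v)

theorem smoothInCoords_iff_smoothInCoordsAt : SmoothInCoords I e₁ e₂ f ↔
    ∀ x ∈ e₁.triv.baseSet ∩ e₂.triv.baseSet, SmoothInCoordsAt I e₁ e₂ f x := by
  have hopen : IsOpen (e₁.triv.baseSet ∩ e₂.triv.baseSet) :=
    e₁.triv.open_baseSet.inter e₂.triv.open_baseSet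
  constructor
  · rintro ⟨g, hg, hgf⟩ x hx
    have hx' := hopen.mem_nhds hx
    exact ⟨g, hg.contMDiffAt hx', eventually_of_mem hx' hgf⟩
  · intro h
    choose! g hg hgf using h
    refine ⟨fun x => g x x, fun x hx => ?_, fun x hx => (hgf x hx).self_of_nhds⟩
    refine ((hg x hx).congr_of_eventuallyEq ?_).contMDiffWithinAt
    filter_upwards [hopen.mem_nhds hx, hgf x hx] with y hy hgy
    refine Hom.ext fun m => ?_
    rw [← e₁.coord_symmCoord hy.1 m, (hgf y hy).self_of_nhds, hgy]

namespace SmoothInCoordsAt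

theorem comp {g : ∀ x, W₂.fiber x → W₃.fiber x} (hg : SmoothInCoordsAt I e₂ e₃ g x)
    (hf : SmoothInCoordsAt I e₁ e₂ f x) :
    SmoothInCoordsAt I e₁ e₃ (fun x v => g x (f x v)) x := by
  obtain ⟨F, hF, hFf⟩ := hf
  obtain ⟨G, hG, hGg⟩ := hg
  refine ⟨fun y => Hom.comp (G y) (F y), Hom.contMDiffAt_comp hG hF, ?_⟩
  filter_upwards [hFf, hGg] with y hFy hGy v
  exact (congrArg (G y).1 (hFy v)).trans (hGy _)

theorem sum {ι : Type*} {s : Finset ι} {f : ι → ∀ x, W₁.fiber x → W₂.fiber x}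
    (hx : x ∈ e₂.triv.baseSet) (h : ∀ i ∈ s, SmoothInCoordsAt I e₁ e₂ (f i) x) :
    SmoothInCoordsAt I e₁ e₂ (fun x v => ∑ i ∈ s, f i x v) x := by
  choose! g hg hgf using h
  refine ⟨fun y => ∑ i ∈ s, g i y, contMDiffAt_finsetSum hg, ?_⟩
  filter_upwards [e₂.triv.open_baseSet.mem_nhds hx, (eventually_all_finset s).2 hgf] with y hy hgy v
  rw [(e₂.isAdjoint_coord hy).map_sum, Submodule.coe_sum, sum_apply]
  exact Finset.sum_congr rfl fun i hi => hgy i hi v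

theorem real_smul {r : X → ℝ} (hr : ContMDiff I 𝓘(ℝ, ℝ) ∞ r) (hx : x ∈ e₂.triv.baseSet)
    (hf : x ∈ tsupport r → SmoothInCoordsAt I e₁ e₂ f x) :
    SmoothInCoordsAt I e₁ e₂ (fun x v => r x • f x v) x := by
  by_cases hxr : x ∈ tsupport r
  · obtain ⟨g, hg, hgf⟩ := hf hxr
    refine ⟨fun y => r y • g y, hr.contMDiffAt.smul hg, ?_⟩
    filter_upwards [e₂.triv.open_baseSet.mem_nhds hx, hgf] with y hy hgy v
    rw [(e₂.isAdjoint_coord hy).map_real_smul, ← hgy]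
    rfl
  · refine ⟨fun _ => 0, contMDiffAt_const, ?_⟩
    filter_upwards [e₂.triv.open_baseSet.mem_nhds hx, notMem_tsupport_iff_eventuallyEq.1 hxr]
      with y hy hry v
    rw [hry, Pi.zero_apply, zero_smul, (e₂.isAdjoint_coord hy).map_zero]
    rfl

end SmoothInCoordsAt

variable {S₁ : SmoothStructure I W₁} {S₂ : SmoothStructure I W₂} {S₃ : SmoothStructure I W₃}

theorem isSmoothMap_of_smoothInCoordsAt
    (h : ∀ e₁ ∈ S₁.atlas, ∀ e₂ ∈ S₂.atlas, ∀ x ∈ e₁.triv.baseSet ∩ e₂.triv.baseSet,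
      SmoothInCoordsAt I e₁ e₂ f x) : IsSmoothMap S₁ S₂ f :=
  fun e₁ he₁ e₂ he₂ => smoothInCoords_iff_smoothInCoordsAt.2 (h e₁ he₁ e₂ he₂)

theorem IsSmoothMap.smoothInCoordsAt (h : IsSmoothMap S₁ S₂ f) (he₁ : e₁ ∈ S₁.atlas)
    (he₂ : e₂ ∈ S₂.atlas) (hx : x ∈ e₁.triv.baseSet ∩ e₂.triv.baseSet) :
    SmoothInCoordsAt I e₁ e₂ f x :=
  smoothInCoords_iff_smoothInCoordsAt.1 (h e₁ he₁ e₂ he₂) x hx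

theorem IsSmoothMap.comp {g : ∀ x, W₂.fiber x → W₃.fiber x} (hg : IsSmoothMap S₂ S₃ g)
    (hf : IsSmoothMap S₁ S₂ f) : IsSmoothMap S₁ S₃ fun x v => g x (f x v) :=
  isSmoothMap_of_smoothInCoordsAt fun _ he₁ _ he₃ x hx =>
    have ⟨_, he₂, hx₂⟩ := S₂.exists_mem x
    (hg.smoothInCoordsAt he₂ he₃ ⟨hx₂, hx.2⟩).comp (hf.smoothInCoordsAt he₁ he₂ ⟨hx.1, hx₂⟩)

theorem isSmoothMap_trivial {V₁ : HilbertModule.{u, w₁} A} {V₂ : HilbertModule.{u, w₂} A}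
    {g : X → Hom V₁ V₂} (hg : ContMDiff I 𝓘(ℝ, Hom V₁ V₂) ∞ g) :
    IsSmoothMap (trivialSmooth I X V₁) (trivialSmooth I X V₂) fun x v => (g x).1 v := by
  rintro _ rfl _ rfl
  exact ⟨g, hg.contMDiffOn, fun _ _ _ => rfl⟩

end Smooth

end HilbertModuleFamily

namespace HilbertModuleFamily

open HilbertModule Filter Topology

variable {A : Type u} [CStarAlgebra A] [PartialOrder A] [StarOrderedRing A] {X : Type v}
  [TopologicalSpace X]

/-- A continuous isometric embedding of a family of Hilbert modules in the trivial bundle `X × Aⁿ`,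
together with its fiberwise adjoint. In terms of the images of the standard basis vectors under
`synthesis`, this is a Parseval frame with `n` elements in every fiber, depending continuously on
the point. -/
structure ParsevalFrame (W : HilbertModuleFamily.{u, v, w} A X) (n : ℕ) where
  analysis : ∀ x, W.fiber x → std A n
  synthesis : ∀ x, std A n → W.fiber x
  isAdjoint : ∀ x, IsAdjoint (analysis x) (synthesis x)
  synthesis_analysis : ∀ x v, synthesis x (analysis x v) = v
  continuous_analysis :
    Continuous fun q : W.Total => ((q.base, analysis q.base q.vec) : X × std A n)
  continuous_synthesis : Continuous fun q : X × std A n => (⟨q.1, synthesis q.1 q.2⟩ : W.Total)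

namespace ParsevalFrame

variable {n : ℕ} {W : HilbertModuleFamily.{u, v, w} A X} (F : W.ParsevalFrame n)
  {W₁ : HilbertModuleFamily.{u, v, w₁} A X} {W₂ : HilbertModuleFamily.{u, v, w₂} A X}
  {W₃ : HilbertModuleFamily.{u, v, w₃} A X} (F₁ : W₁.ParsevalFrame n) (F₂ : W₂.ParsevalFrame n)
  (F₃ : W₃.ParsevalFrame n)

section GramMatrix

/-- The matrix of `analysis ∘ synthesis`, i.e. of the projection of `Aⁿ` onto the embedded fiber.
Its entries are the inner products of the elements of the frame. -/
noncomputable def gramMatrix (x : X) : CStarMatrix (Fin n) (Fin n) A :=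
  toMatrix (F.analysis x ∘ F.synthesis x)

theorem matrixAct_gramMatrix (x : X) (a : std A n) :
    matrixAct (F.gramMatrix x) a = F.analysis x (F.synthesis x a) :=
  matrixAct_toMatrix ((F.isAdjoint x).comp (F.isAdjoint x).symm).toLinearMap a

theorem matrixAct_gramMatrix_analysis (x : X) (v : W.fiber x) :
    matrixAct (F.gramMatrix x) (F.analysis x v) = F.analysis x v := by
  rw [matrixAct_gramMatrix, synthesis_analysis]

theorem synthesis_matrixAct_gramMatrix (x : X) (a : std A n) :
    F.synthesis x (matrixAct (F.gramMatrix x) a) = F.synthesis x a := by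
  rw [matrixAct_gramMatrix, synthesis_analysis]

theorem isStarProjection_gramMatrix (x : X) : IsStarProjection (F.gramMatrix x) where
  isIdempotentElem := matrix_ext fun a => by
    rw [matrixAct_mul, F.matrixAct_gramMatrix x a, matrixAct_gramMatrix_analysis]
  isSelfAdjoint := matrix_ext fun a => (std A n).ext_ip fun b => by
    rw [(isAdjoint_matrixAct _).symm, matrixAct_gramMatrix, matrixAct_gramMatrix]
    exact (((F.isAdjoint x).comp (F.isAdjoint x).symm) a b).symm

theorem continuous_gramMatrix : Continuous F.gramMatrix :=
  continuous_toMatrix fun _ => continuous_snd.comp (F.continuous_analysis.comp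
    (F.continuous_synthesis.comp (continuous_id.prodMk continuous_const)))

/-- The projection valued function given by the Gram matrices. -/
noncomputable def gram : ProjectionFunction A X n where
  toFun := F.gramMatrix
  continuous_toFun := F.continuous_gramMatrix
  isStarProjection := F.isStarProjection_gramMatrix

end GramMatrix

section MapMatrix

/-- The map between fibers given by a matrix with respect to two frames. -/
noncomputable def mapMatrix (M : CStarMatrix (Fin n) (Fin n) A) (x y : X) (v : W₁.fiber x) :
    W₂.fiber y :=
  F₂.synthesis y (matrixAct M (F₁.analysis x v))

theorem matrixAct_analysis_mapMatrix (N M : CStarMatrix (Fin n) (Fin n) A) (x y : X)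
    (v : W₁.fiber x) : matrixAct N (F₂.analysis y (F₁.mapMatrix F₂ M x y v)) =
      matrixAct (N * F₂.gramMatrix y * M) (F₁.analysis x v) := by
  rw [mapMatrix, ← matrixAct_gramMatrix, matrixAct_mul, matrixAct_mul]

theorem mapMatrix_mapMatrix (N M : CStarMatrix (Fin n) (Fin n) A) (x y z : X) (v : W₁.fiber x) :
    F₂.mapMatrix F₃ N y z (F₁.mapMatrix F₂ M x y v) =
      F₁.mapMatrix F₃ (N * F₂.gramMatrix y * M) x z v :=
  congrArg (F₃.synthesis z) (F₁.matrixAct_analysis_mapMatrix F₂ N M x y v)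

theorem mapMatrix_gramMatrix (x : X) (v : W.fiber x) :
    F.mapMatrix F (F.gramMatrix x) x x v = v := by
  rw [mapMatrix, synthesis_matrixAct_gramMatrix, synthesis_analysis]

theorem isAdjoint_mapMatrix (M : CStarMatrix (Fin n) (Fin n) A) (x y : X) :
    IsAdjoint (F₁.mapMatrix F₂ M x y) (F₂.mapMatrix F₁ (star M) y x) :=
  (F₂.isAdjoint y).symm.comp ((isAdjoint_matrixAct M).comp (F₁.isAdjoint x))

section Continuity

variable {Y : Type*} [TopologicalSpace Y] {f : Y → W₁.Total} {b : Y → X}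
  {M : Y → CStarMatrix (Fin n) (Fin n) A} {y : Y}

theorem continuous_base {W : HilbertModuleFamily.{u, v, w} A X} (F : W.ParsevalFrame n) :
    Continuous fun q : W.Total => q.base :=
  continuous_fst.comp F.continuous_analysis

theorem continuous_total_mk {W : HilbertModuleFamily.{u, v, w} A X} (F : W.ParsevalFrame n)
    (x : X) : Continuous fun v : W.fiber x => (⟨x, v⟩ : W.Total) := by
  simpa only [Function.comp_def, F.synthesis_analysis] using
    F.continuous_synthesis.comp ((continuous_const (y := x)).prodMk (F.isAdjoint x).continuous)

theorem continuousAt_matrixAct_analysis (hM : ContinuousAt M y) (hf : ContinuousAt f y) :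
    ContinuousAt (fun z => matrixAct (M z) (F₁.analysis (f z).base (f z).vec)) y :=
  continuous_matrixAct_uncurry.continuousAt.comp
    (f := fun z => (M z, F₁.analysis (f z).base (f z).vec)) (hM.prodMk
    ((continuous_snd.comp F₁.continuous_analysis).continuousAt.comp hf))

theorem continuousAt_mapMatrix (hM : ContinuousAt M y) (hf : ContinuousAt f y)
    (hb : ContinuousAt b y) :
    ContinuousAt (fun z => (⟨b z, F₁.mapMatrix F₂ (M z) (f z).base (b z) (f z).vec⟩ : W₂.Total))
      y :=
  F₂.continuous_synthesis.continuousAt.comp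
    (hb.prodMk (F₁.continuousAt_matrixAct_analysis hM hf))

end Continuity

end MapMatrix

section Iso

variable {x y : X} {M : CStarMatrix (Fin n) (Fin n) A} {U : X → CStarMatrix (Fin n) (Fin n) A}

/-- The isomorphism between two fibers given by a partial isometry between the Gram matrices. -/
noncomputable def fiberIso
    (hM : IsPartialIsometryBetween M (F₁.gramMatrix x) (F₂.gramMatrix y)) :
    IsometricIso (W₁.fiber x) (W₂.fiber y) :=
  have hleft (v : W₁.fiber x) :
      F₂.mapMatrix F₁ (star M) y x (F₁.mapMatrix F₂ M x y v) = v := by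
    rw [mapMatrix_mapMatrix, mul_assoc, hM.final_mul (F₂.isStarProjection_gramMatrix y),
      hM.star_mul_self, mapMatrix_gramMatrix]
  have hright (v : W₂.fiber y) :
      F₁.mapMatrix F₂ M x y (F₂.mapMatrix F₁ (star M) y x v) = v := by
    rw [mapMatrix_mapMatrix, hM.mul_initial (F₁.isStarProjection_gramMatrix x),
      hM.mul_star_self, mapMatrix_gramMatrix]
  (F₁.isAdjoint_mapMatrix F₂ M x y).isometricIso hleft hright

/-- The isomorphism of bundles given by a continuous function with values in the partial isometries
between the Gram matrices. -/
noncomputable def iso (hU : Continuous U)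
    (hpartial : ∀ x, IsPartialIsometryBetween (U x) (F₁.gramMatrix x) (F₂.gramMatrix x)) :
    Iso W₁ W₂ where
  fiberEquiv x := (F₁.fiberIso F₂ (hpartial x)).toLinearEquiv
  adjointable x := ⟨_, (F₁.fiberIso F₂ (hpartial x)).isAdjoint⟩
  continuous_toFun := continuous_iff_continuousAt.2 fun _ =>
    F₁.continuousAt_mapMatrix F₂ (hU.comp F₁.continuous_base).continuousAt continuousAt_id
      F₁.continuous_base.continuousAt
  continuous_invFun := continuous_iff_continuousAt.2 fun _ =>
    F₂.continuousAt_mapMatrix F₁ (hU.comp F₂.continuous_base).star.continuousAt continuousAt_id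
      F₂.continuous_base.continuousAt

theorem isIsometric_iso (hU : Continuous U)
    (hpartial : ∀ x, IsPartialIsometryBetween (U x) (F₁.gramMatrix x) (F₂.gramMatrix x)) :
    (F₁.iso F₂ hU hpartial).IsIsometric :=
  fun x => (F₁.fiberIso F₂ (hpartial x)).ip_map

variable {F₁ F₂}

theorem exists_isometric_iso_of_norm_sub_lt
    (h : ∀ x, ‖F₁.gramMatrix x - F₂.gramMatrix x‖ < 1) : ∃ Φ : Iso W₁ W₂, Φ.IsIsometric :=
  have hU : Continuous fun x => align (F₁.gramMatrix x) (F₂.gramMatrix x) :=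
    continuousOn_univ.1 <| continuousOn_align F₁.continuous_gramMatrix.continuousOn
      F₂.continuous_gramMatrix.continuousOn fun x _ =>
        ⟨F₁.isStarProjection_gramMatrix x, F₂.isStarProjection_gramMatrix x, h x⟩
  ⟨_, F₁.isIsometric_iso F₂ hU fun x => isPartialIsometryBetween_align
    (F₁.isStarProjection_gramMatrix x) (F₂.isStarProjection_gramMatrix x) (h x)⟩

/-- The composition of an isometric isomorphism with a frame. -/
def pullback {Φ : Iso W₁ W₂} (hΦ : Φ.IsIsometric) (F : W₂.ParsevalFrame n) :
    W₁.ParsevalFrame n where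
  analysis x v := F.analysis x (Φ.fiberEquiv x v)
  synthesis x a := (Φ.fiberEquiv x).symm (F.synthesis x a)
  isAdjoint x := (F.isAdjoint x).comp (IsometricIso.mk (Φ.fiberEquiv x) (hΦ x)).isAdjoint
  synthesis_analysis x v := by rw [F.synthesis_analysis, LinearEquiv.symm_apply_apply]
  continuous_analysis := F.continuous_analysis.comp Φ.continuous_toFun
  continuous_synthesis := Φ.continuous_invFun.comp F.continuous_synthesis

theorem gramMatrix_pullback {Φ : Iso W₁ W₂} (hΦ : Φ.IsIsometric) (F : W₂.ParsevalFrame n) :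
    (F.pullback hΦ).gramMatrix = F.gramMatrix :=
  funext fun x => matrix_ext fun a => by
    rw [matrixAct_gramMatrix, matrixAct_gramMatrix]
    exact congrArg (F.analysis x) (LinearEquiv.apply_symm_apply _ _)

end Iso

section LocalTrivialization

variable (x₀ : X)

/-- The neighborhood of `x₀` over which the fibers are identified with the fiber at `x₀`. -/
def nearSet : Set X := {x | ‖F.gramMatrix x - F.gramMatrix x₀‖ < 1}

theorem isOpen_nearSet : IsOpen (F.nearSet x₀) :=
  isOpen_lt (F.continuous_gramMatrix.sub continuous_const).norm continuous_const

theorem mem_nearSet_self : x₀ ∈ F.nearSet x₀ := by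
  simp only [nearSet, Set.mem_ofPred_eq, sub_self, norm_zero, zero_lt_one]

/-- The partial isometry between the Gram matrices at `x` and at `x₀`, for `x` close to `x₀`. -/
noncomputable def alignAt (x : X) : CStarMatrix (Fin n) (Fin n) A :=
  align (F.gramMatrix x) (F.gramMatrix x₀)

variable {x₀} in
theorem isPartialIsometryBetween_alignAt {x : X} (hx : x ∈ F.nearSet x₀) :
    IsPartialIsometryBetween (F.alignAt x₀ x) (F.gramMatrix x) (F.gramMatrix x₀) :=
  isPartialIsometryBetween_align (F.isStarProjection_gramMatrix x)
    (F.isStarProjection_gramMatrix x₀) hx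

variable {x₀} in
theorem continuousAt_alignAt {x : X} (hx : x ∈ F.nearSet x₀) :
    ContinuousAt (F.alignAt x₀) x :=
  have hon : ContinuousOn (F.alignAt x₀) (F.nearSet x₀) :=
    continuousOn_align F.continuous_gramMatrix.continuousOn continuousOn_const fun _ hy =>
      ⟨F.isStarProjection_gramMatrix _, F.isStarProjection_gramMatrix x₀, hy⟩
  hon.continuousAt ((F.isOpen_nearSet x₀).mem_nhds hx)

theorem continuousOn_mapMatrix_alignAt :
    ContinuousOn (fun q : W.Total => (q.base, F.mapMatrix F (F.alignAt x₀ q.base) q.base x₀ q.vec))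
      (W.proj ⁻¹' F.nearSet x₀) := fun q hq =>
  have halign : ContinuousAt (fun q : W.Total => F.alignAt x₀ q.base) q :=
    (F.continuousAt_alignAt hq).comp (f := FiberTotal.base) F.continuous_base.continuousAt
  have hcoord := F.continuousAt_matrixAct_analysis halign continuousAt_id
  (F.continuous_base.continuousAt.prodMk
    ((F.isAdjoint x₀).symm.continuous.continuousAt.comp hcoord)).continuousWithinAt

theorem continuousOn_mapMatrix_star_alignAt :
    ContinuousOn (fun p : X × W.fiber x₀ =>
        (⟨p.1, F.mapMatrix F (star (F.alignAt x₀ p.1)) x₀ p.1 p.2⟩ : W.Total))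
      (F.nearSet x₀ ×ˢ Set.univ) := fun p hp =>
  have halign : ContinuousAt (fun p : X × W.fiber x₀ => star (F.alignAt x₀ p.1)) p :=
    ((F.continuousAt_alignAt hp.1).comp (f := Prod.fst) continuousAt_fst).star
  have htotal : Continuous fun p : X × W.fiber x₀ => (⟨x₀, p.2⟩ : W.Total) :=
    (F.continuous_total_mk x₀).comp continuous_snd
  (F.continuousAt_mapMatrix F halign htotal.continuousAt continuousAt_fst).continuousWithinAt

/-- The local trivialization around `x₀` defined by a frame. -/
noncomputable def localTriv : W.LocalTrivialization where
  model := W.fiber x₀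
  triv :=
    { toFun := fun q => (q.base, F.mapMatrix F (F.alignAt x₀ q.base) q.base x₀ q.vec)
      invFun := fun p => ⟨p.1, F.mapMatrix F (star (F.alignAt x₀ p.1)) x₀ p.1 p.2⟩
      source := W.proj ⁻¹' F.nearSet x₀
      target := F.nearSet x₀ ×ˢ Set.univ
      map_source' := fun _ hq => ⟨hq, Set.mem_univ _⟩
      map_target' := fun _ hp => hp.1
      left_inv' := fun q hq => congrArg (FiberTotal.mk q.base)
        ((F.fiberIso F (F.isPartialIsometryBetween_alignAt hq)).toLinearEquiv.left_inv q.vec)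
      right_inv' := fun p hp => congrArg (Prod.mk p.1)
        ((F.fiberIso F (F.isPartialIsometryBetween_alignAt hp.1)).toLinearEquiv.right_inv p.2)
      open_source := (F.isOpen_nearSet x₀).preimage F.continuous_base
      open_target := (F.isOpen_nearSet x₀).prod isOpen_univ
      continuousOn_toFun := F.continuousOn_mapMatrix_alignAt x₀
      continuousOn_invFun := F.continuousOn_mapMatrix_star_alignAt x₀
      baseSet := F.nearSet x₀
      open_baseSet := F.isOpen_nearSet x₀
      source_eq := rfl
      target_eq := rfl
      proj_toFun := fun _ _ => rfl }
  isometric _ hx := ⟨F.fiberIso F (F.isPartialIsometryBetween_alignAt hx), fun _ => rfl⟩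

theorem isBundle (F : W.ParsevalFrame n) : W.IsBundle :=
  fun x => ⟨F.localTriv x, F.mem_nearSet_self x⟩

end LocalTrivialization

section Smooth

variable {E : Type*} [NormedAddCommGroup E] [NormedSpace ℝ E] {H : Type*} [TopologicalSpace H]
  {I : ModelWithCorners ℝ E H} [ChartedSpace H X] {F F₁ F₂}
  {S : SmoothStructure I W} {S₁ : SmoothStructure I W₁} {S₂ : SmoothStructure I W₂}

theorem contMDiffAt_alignAt
    (h : ContMDiff I 𝓘(ℝ, CStarMatrix (Fin n) (Fin n) A) ∞ F.gramMatrix) {x₀ x : X}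
    (hx : x ∈ F.nearSet x₀) :
    ContMDiffAt I 𝓘(ℝ, CStarMatrix (Fin n) (Fin n) A) ∞ (F.alignAt x₀) x :=
  have hon : ContMDiffOn I 𝓘(ℝ, CStarMatrix (Fin n) (Fin n) A) ∞ (F.alignAt x₀) (F.nearSet x₀) :=
    contMDiffOn_align h.contMDiffOn contMDiffOn_const fun _ hy =>
      ⟨F.isStarProjection_gramMatrix _, F.isStarProjection_gramMatrix x₀, hy⟩
  hon.contMDiffAt ((F.isOpen_nearSet x₀).mem_nhds hx)

theorem contMDiffAt_matrixHom {M : X → CStarMatrix (Fin n) (Fin n) A} {x : X}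
    (hM : ContMDiffAt I 𝓘(ℝ, CStarMatrix (Fin n) (Fin n) A) ∞ M x) :
    ContMDiffAt I 𝓘(ℝ, Hom (std A n) (std A n)) ∞ (fun x => matrixHom A n (M x)) x :=
  contDiff_matrixHom.contMDiff.contMDiffAt.comp x hM

theorem smoothInCoordsAt_analysis
    (h : ContMDiff I 𝓘(ℝ, CStarMatrix (Fin n) (Fin n) A) ∞ F.gramMatrix) {x₀ x : X}
    (hx : x ∈ F.nearSet x₀) :
    SmoothInCoordsAt I (F.localTriv x₀) (trivialChart X (std A n)) F.analysis x := by
  refine ⟨fun y => Hom.comp (matrixHom A n (star (F.alignAt x₀ y))) (F.isAdjoint x₀).toHom,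
    Hom.contMDiffAt_comp (contMDiffAt_matrixHom
      (contMDiffAt_star (contMDiffAt_alignAt h hx))) contMDiffAt_const, ?_⟩
  filter_upwards [(F.isOpen_nearSet x₀).mem_nhds hx] with y hy v
  have hU := F.isPartialIsometryBetween_alignAt hy
  change matrixAct _ (F.analysis x₀ (F.mapMatrix F (F.alignAt x₀ y) y x₀ v)) = F.analysis y v
  rw [matrixAct_analysis_mapMatrix, mul_assoc, hU.final_mul (F.isStarProjection_gramMatrix x₀),
    hU.star_mul_self, matrixAct_gramMatrix_analysis]

theorem smoothInCoordsAt_synthesis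
    (h : ContMDiff I 𝓘(ℝ, CStarMatrix (Fin n) (Fin n) A) ∞ F.gramMatrix) {x₀ x : X}
    (hx : x ∈ F.nearSet x₀) :
    SmoothInCoordsAt I (trivialChart X (std A n)) (F.localTriv x₀) F.synthesis x := by
  refine ⟨fun y => Hom.comp (F.isAdjoint x₀).symm.toHom (matrixHom A n (F.alignAt x₀ y)),
    Hom.contMDiffAt_comp contMDiffAt_const
      (contMDiffAt_matrixHom (contMDiffAt_alignAt h hx)), ?_⟩
  filter_upwards [(F.isOpen_nearSet x₀).mem_nhds hx] with y hy
  have hU := F.isPartialIsometryBetween_alignAt hy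
  intro (a : std A n)
  change F.synthesis x₀ (matrixAct (F.alignAt x₀ y) a) =
    F.synthesis x₀ (matrixAct (F.alignAt x₀ y) (F.analysis y (F.synthesis y a)))
  rw [← matrixAct_gramMatrix, ← matrixAct_mul, hU.mul_initial (F.isStarProjection_gramMatrix y)]

/-- The smooth structure defined by a frame with smooth Gram matrix. -/
noncomputable def smoothStructure
    (h : ContMDiff I 𝓘(ℝ, CStarMatrix (Fin n) (Fin n) A) ∞ F.gramMatrix) :
    SmoothStructure I W where
  atlas := Set.range F.localTriv
  exists_mem x := ⟨_, ⟨x, rfl⟩, F.mem_nearSet_self x⟩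
  smooth_transition := by
    rintro _ ⟨x₁, rfl⟩ _ ⟨x₂, rfl⟩
    refine smoothInCoords_iff_smoothInCoordsAt.2 fun x hx => ?_
    have hcomp := (smoothInCoordsAt_synthesis h hx.2).comp (smoothInCoordsAt_analysis h hx.1)
    simpa only [F.synthesis_analysis] using hcomp

variable (F S) in
/-- The embedding in `X × Aⁿ` given by the frame and its adjoint are smooth. -/
def IsSmooth : Prop :=
  IsSmoothMap S (trivialSmooth I X (std A n)) F.analysis ∧
    IsSmoothMap (trivialSmooth I X (std A n)) S F.synthesis

theorem isSmooth_smoothStructure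
    (h : ContMDiff I 𝓘(ℝ, CStarMatrix (Fin n) (Fin n) A) ∞ F.gramMatrix) :
    F.IsSmooth (smoothStructure h) := by
  constructor
  · refine isSmoothMap_of_smoothInCoordsAt ?_
    rintro _ ⟨x₀, rfl⟩ _ rfl x hx
    exact smoothInCoordsAt_analysis h hx.1
  · refine isSmoothMap_of_smoothInCoordsAt ?_
    rintro _ rfl _ ⟨x₀, rfl⟩ x hx
    exact smoothInCoordsAt_synthesis h hx.2

theorem IsSmooth.contMDiff_gramMatrix (h : F.IsSmooth S) :
    ContMDiff I 𝓘(ℝ, CStarMatrix (Fin n) (Fin n) A) ∞ F.gramMatrix := fun x => by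
  obtain ⟨g, hg, hgF⟩ :=
    (h.1.comp h.2).smoothInCoordsAt rfl rfl ⟨Set.mem_univ x, Set.mem_univ x⟩
  refine (contDiff_toMatrix.contMDiff.contMDiffAt.comp x hg).congr_of_eventuallyEq ?_
  exact hgF.mono fun y hy => congrArg toMatrix (funext fun a => (hy a).symm)

theorem IsSmooth.isSmoothMap_mapMatrix (h₁ : F₁.IsSmooth S₁) (h₂ : F₂.IsSmooth S₂)
    {M : X → CStarMatrix (Fin n) (Fin n) A}
    (hM : ContMDiff I 𝓘(ℝ, CStarMatrix (Fin n) (Fin n) A) ∞ M) :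
    IsSmoothMap S₁ S₂ fun x => F₁.mapMatrix F₂ (M x) x x :=
  h₂.2.comp ((isSmoothMap_trivial fun x => contMDiffAt_matrixHom (hM x)).comp h₁.1)

theorem IsSmooth.isSmooth_iso (h₁ : F₁.IsSmooth S₁) (h₂ : F₂.IsSmooth S₂)
    {U : X → CStarMatrix (Fin n) (Fin n) A}
    (hU : ContMDiff I 𝓘(ℝ, CStarMatrix (Fin n) (Fin n) A) ∞ U)
    (hpartial : ∀ x, IsPartialIsometryBetween (U x) (F₁.gramMatrix x) (F₂.gramMatrix x)) :
    (F₁.iso F₂ hU.continuous hpartial).IsSmooth S₁ S₂ :=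
  ⟨h₁.isSmoothMap_mapMatrix h₂ hU, h₂.isSmoothMap_mapMatrix h₁ fun x => contMDiffAt_star (hU x)⟩

theorem IsSmooth.exists_isometric_isSmooth_iso_of_norm_sub_lt (h₁ : F₁.IsSmooth S₁)
    (h₂ : F₂.IsSmooth S₂) (h : ∀ x, ‖F₁.gramMatrix x - F₂.gramMatrix x‖ < 1) :
    ∃ Φ : Iso W₁ W₂, Φ.IsIsometric ∧ Φ.IsSmooth S₁ S₂ :=
  have hU : ContMDiff I 𝓘(ℝ, CStarMatrix (Fin n) (Fin n) A) ∞
      fun x => align (F₁.gramMatrix x) (F₂.gramMatrix x) :=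
    contMDiffOn_univ.1 <| contMDiffOn_align h₁.contMDiff_gramMatrix.contMDiffOn
      h₂.contMDiff_gramMatrix.contMDiffOn fun x _ =>
        ⟨F₁.isStarProjection_gramMatrix x, F₂.isStarProjection_gramMatrix x, h x⟩
  have hpartial x := isPartialIsometryBetween_align (F₁.isStarProjection_gramMatrix x)
    (F₂.isStarProjection_gramMatrix x) (h x)
  ⟨_, F₁.isIsometric_iso F₂ hU.continuous hpartial, h₁.isSmooth_iso h₂ hU hpartial⟩

end Smooth

end ParsevalFrame

end HilbertModuleFamily

section SquarePartition

variable {ι : Type*} [Fintype ι] {X : Type*} [TopologicalSpace X] {U : ι → Set X}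

theorem sum_sq_pos_of_sum_eq_one {f : ι → ℝ} (h : ∑ i, f i = 1) : 0 < ∑ i, f i ^ 2 := by
  obtain ⟨i, hi, hne⟩ := Finset.exists_ne_zero_of_sum_ne_zero (h.trans_ne one_ne_zero)
  exact Finset.sum_pos' (fun j _ => sq_nonneg (f j)) ⟨i, hi, by positivity⟩

theorem sum_sq_mul_inv_sqrt_eq_one {f : ι → ℝ} (h : ∑ i, f i = 1) :
    ∑ i, (f i * (√(∑ j, f j ^ 2))⁻¹) ^ 2 = 1 := by
  have hpos := sum_sq_pos_of_sum_eq_one h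
  simp only [mul_pow, inv_pow, Real.sq_sqrt hpos.le, ← Finset.sum_mul]
  exact mul_inv_cancel₀ hpos.ne'

theorem exists_continuous_sum_sq_eq_one [NormalSpace X] (hU : ∀ i, IsOpen (U i))
    (hcover : ∀ x, ∃ i, x ∈ U i) :
    ∃ ρ : ι → X → ℝ, (∀ i, Continuous (ρ i)) ∧ (∀ i, tsupport (ρ i) ⊆ U i) ∧
      ∀ x, ∑ i, ρ i x ^ 2 = 1 := by
  obtain ⟨f, hf⟩ := PartitionOfUnity.exists_isSubordinate_of_locallyFinite isClosed_univ U hU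
    (locallyFinite_of_finite U) fun x _ => Set.mem_iUnion.2 (hcover x)
  have hsum x : ∑ i, f i x = 1 := by
    rw [← f.sum_eq_one (Set.mem_univ x), finsum_eq_sum_of_fintype]
  refine ⟨fun i x => f i x * (√(∑ j, f j x ^ 2))⁻¹, fun i => ?_,
    fun i => (tsupport_mul_subset_left).trans (hf i), fun x => sum_sq_mul_inv_sqrt_eq_one (hsum x)⟩
  have hsqrt : Continuous fun x => √(∑ j, f j x ^ 2) :=
    (continuous_finsetSum _ fun j _ => (f j).continuous.pow 2).sqrt
  exact (f i).continuous.mul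
    (hsqrt.inv₀ fun x => (Real.sqrt_pos.2 (sum_sq_pos_of_sum_eq_one (hsum x))).ne')

theorem exists_contMDiff_sum_sq_eq_one {E : Type*} [NormedAddCommGroup E] [NormedSpace ℝ E]
    [FiniteDimensional ℝ E] {H : Type*} [TopologicalSpace H] (I : ModelWithCorners ℝ E H)
    [ChartedSpace H X] [IsManifold I ∞ X] [SigmaCompactSpace X] [T2Space X]
    (hU : ∀ i, IsOpen (U i)) (hcover : ∀ x, ∃ i, x ∈ U i) :
    ∃ ρ : ι → X → ℝ, (∀ i, ContMDiff I 𝓘(ℝ, ℝ) ∞ (ρ i)) ∧ (∀ i, tsupport (ρ i) ⊆ U i) ∧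
      ∀ x, ∑ i, ρ i x ^ 2 = 1 := by
  obtain ⟨f, hf⟩ := SmoothPartitionOfUnity.exists_isSubordinate I isClosed_univ U hU
    fun x _ => Set.mem_iUnion.2 (hcover x)
  have hsum x : ∑ i, f i x = 1 := by
    rw [← f.sum_eq_one (Set.mem_univ x), finsum_eq_sum_of_fintype]
  refine ⟨fun i x => f i x * (√(∑ j, f j x ^ 2))⁻¹, fun i => ?_,
    fun i => (tsupport_mul_subset_left).trans (hf i), fun x => sum_sq_mul_inv_sqrt_eq_one (hsum x)⟩
  have hsumSq : ContMDiff I 𝓘(ℝ, ℝ) ∞ fun x => ∑ j, f j x ^ 2 :=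
    contMDiff_finsetSum fun j _ => (contDiff_id.pow 2).contMDiff.comp (f j).contMDiff
  have hsqrt : ContMDiff I 𝓘(ℝ, ℝ) ∞ fun x => √(∑ j, f j x ^ 2) := fun x =>
    (Real.contDiffAt_sqrt (sum_sq_pos_of_sum_eq_one (hsum x)).ne').contMDiffAt.comp x (hsumSq x)
  exact (f i).contMDiff.mul
    (hsqrt.inv₀ fun x => (Real.sqrt_pos.2 (sum_sq_pos_of_sum_eq_one (hsum x))).ne')

end SquarePartition

namespace HilbertModule

open Filter

variable {A : Type u} [CStarAlgebra A] [PartialOrder A] [StarOrderedRing A]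

section Coordinates

variable {m n N : ℕ}

/-- The coordinates of a vector of `Aᴺ` along an embedding of index sets. -/
def restrictCoord (φ : Fin n ↪ Fin N) (a : std A N) : std A n :=
  (WithCStarModule.equiv Aᵐᵒᵖ (Fin n → Aᵐᵒᵖ)).symm fun k => a (φ k)

/-- Extension of a vector of `Aⁿ` by zero along an embedding of index sets. -/
noncomputable def extendCoord (φ : Fin n ↪ Fin N) (a : std A n) : std A N :=
  (WithCStarModule.equiv Aᵐᵒᵖ (Fin N → Aᵐᵒᵖ)).symm (Function.extend φ (fun k => a k) 0)

theorem extendCoord_apply (φ : Fin n ↪ Fin N) (a : std A n) (k : Fin n) :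
    extendCoord φ a (φ k) = a k := φ.injective.extend_apply _ _ k

theorem extendCoord_apply_of_notMem_range (φ : Fin n ↪ Fin N) (a : std A n) {i : Fin N}
    (hi : i ∉ Set.range φ) : extendCoord φ a i = 0 := Function.extend_apply' _ _ i hi

theorem isAdjoint_extendCoord (φ : Fin n ↪ Fin N) :
    IsAdjoint (extendCoord (A := A) φ) (restrictCoord φ) := fun a b => by
  rw [std_ip, std_ip]
  refine (Fintype.sum_of_injective φ φ.injective _ _ (fun i hi => ?_) fun k => ?_).symm
  · rw [extendCoord_apply_of_notMem_range φ a hi, unop_zero, star_zero, zero_mul]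
  · rw [extendCoord_apply]
    rfl

theorem restrictCoord_extendCoord (φ : Fin n ↪ Fin N) (a : std A n) :
    restrictCoord φ (extendCoord φ a) = a :=
  std_ext fun k => extendCoord_apply φ a k

theorem restrictCoord_extendCoord_of_disjoint (φ : Fin n ↪ Fin N) (ψ : Fin m ↪ Fin N)
    (h : ∀ k, φ k ∉ Set.range ψ) (a : std A m) : restrictCoord φ (extendCoord ψ a) = 0 :=
  std_ext fun k => extendCoord_apply_of_notMem_range ψ a (h k)

end Coordinates

theorem IsFGP.exists_embedding {V : HilbertModule.{u, w} A} (h : V.IsFGP) :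
    ∃ (n : ℕ) (B : V → std A n) (B' : std A n → V), IsAdjoint B B' ∧ ∀ v, B' (B v) = v := by
  obtain ⟨n, W, ⟨φ⟩⟩ := h
  have hfst : IsAdjoint (fun v => V.prodMk W v 0) (V.prodFst W) := fun v z => by
    change V.ip v _ + W.ip 0 _ = _
    rw [← W.star_ip, W.ip_zero_right, star_zero, add_zero]
    rfl
  exact ⟨n, _, _, φ.isAdjoint.comp hfst,
    fun v => congrArg (V.prodFst W) (φ.toLinearEquiv.symm_apply_apply _)⟩

theorem IsFGP.of_isometricIso {V : HilbertModule.{u, w} A} {V' : HilbertModule.{u, w'} A}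
    (h : V.IsFGP) (f : IsometricIso V V') : V'.IsFGP := by
  obtain ⟨n, W, ⟨φ⟩⟩ := h
  refine ⟨n, W, ⟨⟨(LinearEquiv.prodCongr f.symm.toLinearEquiv (LinearEquiv.refl Aᵐᵒᵖ W)).trans
    φ.toLinearEquiv, fun z z' => ?_⟩⟩⟩
  exact (φ.ip_map _ _).trans (congrArg (· + W.ip z.2 z'.2) (f.symm.ip_map z.1 z'.1))

theorem eventually_exists_orthogonal_embeddings {ι : Type*} [Finite ι]
    {V : ι → HilbertModule.{u, w} A} (h : ∀ i, (V i).IsFGP) :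
    ∀ᶠ N in atTop, ∃ (B : ∀ i, V i → std A N) (B' : ∀ i, std A N → V i),
      (∀ i, IsAdjoint (B i) (B' i)) ∧ (∀ i v, B' i (B i v) = v) ∧
      ∀ i j, i ≠ j → ∀ v, B' i (B j v) = 0 := by
  have := Fintype.ofFinite ι
  choose n C C' hC hC' using fun i => (h i).exists_embedding
  filter_upwards [eventually_ge_atTop (Fintype.card (Σ i, Fin (n i)))] with N hN
  obtain ⟨block⟩ : Nonempty ((Σ i, Fin (n i)) ↪ Fin N) :=
    Function.Embedding.nonempty_of_card_le (by rwa [Fintype.card_fin])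
  let φ i : Fin (n i) ↪ Fin N := (Function.Embedding.sigmaMk i).trans block
  have hdisjoint i j (hij : i ≠ j) (k : Fin (n i)) : φ i k ∉ Set.range (φ j) := fun ⟨_, hl⟩ =>
    hij (congrArg Sigma.fst (block.injective hl)).symm
  refine ⟨fun i => extendCoord (φ i) ∘ C i, fun i => C' i ∘ restrictCoord (φ i),
    fun i => (isAdjoint_extendCoord (φ i)).comp (hC i), fun i v => ?_, fun i j hij v => ?_⟩
  · change C' i (restrictCoord (φ i) (extendCoord (φ i) (C i v))) = v
    rw [restrictCoord_extendCoord, hC']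
  · change C' i (restrictCoord (φ i) (extendCoord (φ j) (C j v))) = 0
    rw [restrictCoord_extendCoord_of_disjoint _ _ (hdisjoint i j hij), (hC i).symm.map_zero]

end HilbertModule

namespace HilbertModuleFamily

open HilbertModule Filter Topology

variable {A : Type u} [CStarAlgebra A] [PartialOrder A] [StarOrderedRing A] {X : Type v}
  [TopologicalSpace X] {W : HilbertModuleFamily.{u, v, w} A X}

/-- The data needed to glue local trivializations to an embedding in a trivial bundle: a square
partition of unity subordinate to the domains of the trivializations, and embeddings of the models
in a Hilbert module `V` with mutually orthogonal images (`coembed i` is the adjoint of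
`embed i`). -/
structure GluingData (W : HilbertModuleFamily.{u, v, w} A X) (ι : Type*) [Fintype ι]
    (V : HilbertModule.{u, w'} A) where
  chart : ι → W.LocalTrivialization
  weight : ι → X → ℝ
  embed : ∀ i, (chart i).model → V
  coembed : ∀ i, V → (chart i).model
  tsupport_weight_subset : ∀ i, tsupport (weight i) ⊆ (chart i).triv.baseSet
  sum_weight_sq : ∀ x, ∑ i, weight i x ^ 2 = 1
  isAdjoint_embed : ∀ i, IsAdjoint (embed i) (coembed i)
  coembed_embed : ∀ i m, coembed i (embed i m) = m
  coembed_embed_of_ne : ∀ i j, i ≠ j → ∀ m, coembed i (embed j m) = 0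

namespace GluingData

variable {ι : Type*} [Fintype ι] {V : HilbertModule.{u, w'} A} (D : W.GluingData ι V)

/-- The embedding of the fibers of `W` in `V`. -/
noncomputable def glue (x : X) (v : W.fiber x) : V :=
  ∑ i, D.weight i x • D.embed i ((D.chart i).coord x v)

/-- The adjoint of `glue`. -/
noncomputable def coglue (x : X) (a : V) : W.fiber x :=
  ∑ i, D.weight i x • (D.chart i).symmCoord x (D.coembed i a)

theorem mem_baseSet_of_weight_ne_zero {i : ι} {x : X} (h : D.weight i x ≠ 0) :
    x ∈ (D.chart i).triv.baseSet :=
  D.tsupport_weight_subset i (subset_tsupport _ h)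

theorem isAdjoint_glue (x : X) : IsAdjoint (D.glue x) (D.coglue x) := fun v a => by
  rw [glue, coglue, ip_sum_left, ip_sum_right]
  refine Finset.sum_congr rfl fun i _ => ?_
  rw [ip_real_smul_left, ip_real_smul_right]
  by_cases h : D.weight i x = 0
  · rw [h, zero_smul, zero_smul]
  · rw [D.isAdjoint_embed i, (D.chart i).isAdjoint_coord (D.mem_baseSet_of_weight_ne_zero h)]

theorem coembed_glue (i : ι) (x : X) (v : W.fiber x) :
    D.coembed i (D.glue x v) = D.weight i x • (D.chart i).coord x v := by
  have hcoembed := (D.isAdjoint_embed i).symm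
  rw [glue, hcoembed.map_sum, Finset.sum_eq_single i, hcoembed.map_real_smul, D.coembed_embed]
  · intro j _ hj
    rw [hcoembed.map_real_smul, D.coembed_embed_of_ne i j hj.symm, smul_zero]
  · exact fun hi => absurd (Finset.mem_univ i) hi

theorem coglue_glue (x : X) (v : W.fiber x) : D.coglue x (D.glue x v) = v := by
  have hterm i : D.weight i x • (D.chart i).symmCoord x (D.coembed i (D.glue x v)) =
      D.weight i x ^ 2 • v := by
    by_cases h : D.weight i x = 0
    · rw [h, zero_smul, sq, zero_mul, zero_smul]
    · have hx := D.mem_baseSet_of_weight_ne_zero h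
      rw [coembed_glue, ((D.chart i).isAdjoint_coord hx).symm.map_real_smul,
        (D.chart i).symmCoord_coord hx, smul_smul, sq]
  rw [coglue, Finset.sum_congr rfl fun i _ => hterm i, ← Finset.sum_smul, D.sum_weight_sq,
    one_smul]

section Continuity

variable (hW : W.IsBundle) (hweight : ∀ i, Continuous (D.weight i))
include hW hweight

theorem continuous_glue : Continuous fun q : W.Total => D.glue q.base q.vec :=
  continuous_iff_continuousAt.2 fun _ => tendsto_finsetSum _ fun i _ =>
    continuousAt_smul_of_mem_tsupport (b := W.proj) (hweight i) hW.continuous_proj.continuousAt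
      fun hi => (D.isAdjoint_embed i).continuous.continuousAt.comp
        ((D.chart i).continuousAt_coord (f := fun q => q) continuousAt_id
          (D.tsupport_weight_subset i hi))

theorem continuous_coglue :
    Continuous fun p : X × V => (⟨p.1, D.coglue p.1 p.2⟩ : W.Total) := by
  refine continuous_iff_continuousAt.2 fun ⟨x, a⟩ => ?_
  obtain ⟨e, he⟩ := hW x
  refine e.continuousAt_total continuousAt_fst he ?_
  have hsum : ContinuousAt (fun p : X × V => ∑ i, D.weight i p.1 •
      e.coord p.1 ((D.chart i).symmCoord p.1 (D.coembed i p.2))) (x, a) :=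
    tendsto_finsetSum _ fun i _ => continuousAt_smul_of_mem_tsupport (b := Prod.fst)
      (hweight i) continuousAt_fst fun hi => e.continuousAt_coord
        ((D.chart i).continuousAt_symmCoord continuousAt_fst (D.tsupport_weight_subset i hi)
          ((D.isAdjoint_embed i).symm.continuous.continuousAt.comp continuousAt_snd)) he
  refine hsum.congr ?_
  filter_upwards [continuousAt_fst.eventually (e.triv.open_baseSet.mem_nhds he)] with p hp
  have hcoord := e.isAdjoint_coord hp
  simp only [coglue, hcoord.map_sum, hcoord.map_real_smul]

end Continuity

section Smooth

variable {E : Type*} [NormedAddCommGroup E] [NormedSpace ℝ E] {H : Type*} [TopologicalSpace H]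
  {I : ModelWithCorners ℝ E H} [ChartedSpace H X]

theorem smoothInCoordsAt_embed (i : ι) {x : X} :
    SmoothInCoordsAt I (D.chart i) (trivialChart X V)
      (fun y v => D.embed i ((D.chart i).coord y v)) x :=
  ⟨fun _ => (D.isAdjoint_embed i).toHom, contMDiffAt_const, .of_forall fun _ _ => rfl⟩

theorem smoothInCoordsAt_coembed (i : ι) {x : X} (hx : x ∈ (D.chart i).triv.baseSet) :
    SmoothInCoordsAt I (trivialChart X V) (D.chart i)
      (fun y a => (D.chart i).symmCoord y (D.coembed i a)) x := by
  refine ⟨fun _ => (D.isAdjoint_embed i).symm.toHom, contMDiffAt_const, ?_⟩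
  filter_upwards [(D.chart i).triv.open_baseSet.mem_nhds hx] with y hy a
  exact ((D.chart i).coord_symmCoord hy _).symm

variable {S : SmoothStructure I W} (hchart : ∀ i, D.chart i ∈ S.atlas)
  (hweight : ∀ i, ContMDiff I 𝓘(ℝ, ℝ) ∞ (D.weight i))
include hchart hweight

theorem isSmoothMap_glue : IsSmoothMap S (trivialSmooth I X V) D.glue := by
  refine isSmoothMap_of_smoothInCoordsAt ?_
  rintro e he _ rfl x hx
  refine SmoothInCoordsAt.sum hx.2 fun i _ =>
    SmoothInCoordsAt.real_smul (hweight i) hx.2 fun hi => ?_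
  exact (D.smoothInCoordsAt_embed i).comp (smoothInCoords_iff_smoothInCoordsAt.1
    (S.smooth_transition e he _ (hchart i)) x ⟨hx.1, D.tsupport_weight_subset i hi⟩)

theorem isSmoothMap_coglue : IsSmoothMap (trivialSmooth I X V) S D.coglue := by
  refine isSmoothMap_of_smoothInCoordsAt ?_
  rintro _ rfl e he x hx
  refine SmoothInCoordsAt.sum hx.2 fun i _ =>
    SmoothInCoordsAt.real_smul (hweight i) hx.2 fun hi => ?_
  have hxi := D.tsupport_weight_subset i hi
  exact (smoothInCoords_iff_smoothInCoordsAt.1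
    (S.smooth_transition _ (hchart i) e he) x ⟨hxi, hx.2⟩).comp (D.smoothInCoordsAt_coembed i hxi)

end Smooth

/-- The frame obtained by gluing local trivializations. -/
noncomputable def parsevalFrame {N : ℕ} (D : W.GluingData ι (std A N)) (hW : W.IsBundle)
    (hweight : ∀ i, Continuous (D.weight i)) : W.ParsevalFrame N where
  analysis := D.glue
  synthesis := D.coglue
  isAdjoint := D.isAdjoint_glue
  synthesis_analysis := D.coglue_glue
  continuous_analysis := hW.continuous_proj.prodMk (D.continuous_glue hW hweight)
  continuous_synthesis := D.continuous_coglue hW hweight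

end GluingData

section FiniteCover

variable {ι : Type*} [Finite ι] {e : ι → W.LocalTrivialization}

theorem eventually_exists_parsevalFrame [NormalSpace X] (hW : W.IsBundle)
    (hfgp : ∀ i, (e i).model.IsFGP) (hcover : ∀ x, ∃ i, x ∈ (e i).triv.baseSet) :
    ∀ᶠ N in atTop, Nonempty (W.ParsevalFrame N) := by
  have := Fintype.ofFinite ι
  obtain ⟨ρ, hρ, hsupp, hsum⟩ := exists_continuous_sum_sq_eq_one
    (fun i => (e i).triv.open_baseSet) hcover
  filter_upwards [eventually_exists_orthogonal_embeddings hfgp]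
    with N ⟨B, B', hadjoint, hself, horth⟩
  exact ⟨GluingData.parsevalFrame ⟨e, ρ, B, B', hsupp, hsum, hadjoint, hself, horth⟩ hW hρ⟩

theorem eventually_exists_isSmooth_parsevalFrame {E : Type*} [NormedAddCommGroup E]
    [NormedSpace ℝ E] [FiniteDimensional ℝ E] {H : Type*} [TopologicalSpace H]
    {I : ModelWithCorners ℝ E H} [ChartedSpace H X] [IsManifold I ∞ X] [SigmaCompactSpace X]
    [T2Space X] (hW : W.IsBundle) {S : SmoothStructure I W} (hS : ∀ i, e i ∈ S.atlas)
    (hfgp : ∀ i, (e i).model.IsFGP) (hcover : ∀ x, ∃ i, x ∈ (e i).triv.baseSet) :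
    ∀ᶠ N in atTop, ∃ F : W.ParsevalFrame N, F.IsSmooth S := by
  have := Fintype.ofFinite ι
  obtain ⟨ρ, hρ, hsupp, hsum⟩ := exists_contMDiff_sum_sq_eq_one I
    (fun i => (e i).triv.open_baseSet) hcover
  filter_upwards [eventually_exists_orthogonal_embeddings hfgp]
    with N ⟨B, B', hadjoint, hself, horth⟩
  let D : W.GluingData ι (std A N) := ⟨e, ρ, B, B', hsupp, hsum, hadjoint, hself, horth⟩
  exact ⟨D.parsevalFrame hW fun i => (hρ i).continuous, D.isSmoothMap_glue hS hρ,
    D.isSmoothMap_coglue hS hρ⟩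

end FiniteCover

namespace IsFGPBundle

theorem isFGP_model (hW : W.IsFGPBundle) (e : W.LocalTrivialization) {x : X}
    (hx : x ∈ e.triv.baseSet) : e.model.IsFGP := (hW.2 x).of_isometricIso (e.fiberIso hx)

theorem exists_finite_cover [CompactSpace X] {e : X → W.LocalTrivialization}
    (he : ∀ x, x ∈ (e x).triv.baseSet) : ∃ t : Finset X, ∀ x, ∃ i : t, x ∈ (e i).triv.baseSet := by
  obtain ⟨t, ht⟩ := CompactSpace.elim_nhds_subcover (fun x => (e x).triv.baseSet)
    fun x => (e x).triv.open_baseSet.mem_nhds (he x)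
  refine ⟨t, fun x => ?_⟩
  have hx : x ∈ ⋃ y ∈ t, (e y).triv.baseSet := ht ▸ Set.mem_univ x
  obtain ⟨i, hi, hxi⟩ := Set.mem_iUnion₂.1 hx
  exact ⟨⟨i, hi⟩, hxi⟩

variable [CompactSpace X] [T2Space X]

theorem eventually_exists_parsevalFrame (hW : W.IsFGPBundle) :
    ∀ᶠ N in atTop, Nonempty (W.ParsevalFrame N) := by
  choose e he using hW.1
  obtain ⟨t, ht⟩ := exists_finite_cover he
  exact HilbertModuleFamily.eventually_exists_parsevalFrame (ι := t) hW.1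
    (fun i => hW.isFGP_model (e i) (he i)) ht

theorem eventually_exists_isSmooth_parsevalFrame {E : Type*} [NormedAddCommGroup E]
    [NormedSpace ℝ E] [FiniteDimensional ℝ E] {H : Type*} [TopologicalSpace H]
    {I : ModelWithCorners ℝ E H} [ChartedSpace H X] [IsManifold I ∞ X] (hW : W.IsFGPBundle)
    (S : SmoothStructure I W) : ∀ᶠ N in atTop, ∃ F : W.ParsevalFrame N, F.IsSmooth S := by
  choose e heS he using S.exists_mem
  obtain ⟨t, ht⟩ := exists_finite_cover he
  exact HilbertModuleFamily.eventually_exists_isSmooth_parsevalFrame (ι := t) hW.1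
    (fun i => heS i) (fun i => hW.isFGP_model (e i) (he i)) ht

end IsFGPBundle

end HilbertModuleFamily

namespace HilbertModule

variable {A : Type u} [CStarAlgebra A] [PartialOrder A] [StarOrderedRing A] {n : ℕ}
  {M : CStarMatrix (Fin n) (Fin n) A}

theorem matrixAct_one_sub (M : CStarMatrix (Fin n) (Fin n) A) (v : std A n) :
    matrixAct (1 - M) v = v - matrixAct M v := by
  rw [eq_sub_iff_add_eq, ← matrixAct_add, sub_add_cancel, matrixAct_one]

theorem mem_projImage (hM : IsStarProjection M) {v : std A n} :
    v ∈ projImage M hM ↔ matrixAct M v = v := by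
  constructor
  · rintro ⟨u, rfl⟩
    rw [← matrixAct_mul, hM.isIdempotentElem.eq]
  · exact fun h => ⟨v, h⟩

theorem isAdjoint_matrixAct_self (hM : IsStarProjection M) :
    IsAdjoint (matrixAct M) (matrixAct M) := by
  simpa only [hM.isSelfAdjoint.star_eq] using isAdjoint_matrixAct M

theorem mem_projImage_one_sub (hM : IsStarProjection M) {v : std A n} :
    v ∈ projImage (1 - M) hM.one_sub ↔ matrixAct M v = 0 := by
  rw [mem_projImage, matrixAct_one_sub, sub_eq_self]

theorem orthogonal_projImage (hM : IsStarProjection M) :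
    (std A n).orthogonal (projImage M hM) = projImage (1 - M) hM.one_sub := by
  ext v
  refine Iff.trans ⟨fun hv => ?_, fun hv a ha => ?_⟩ (mem_projImage_one_sub hM).symm
  · refine (std A n).ext_ip fun a => ?_
    rw [isAdjoint_matrixAct_self hM, ← star_ip, hv _ ⟨a, rfl⟩, ← star_ip, ip_zero_right]
  · rw [← (mem_projImage hM).1 ha, isAdjoint_matrixAct_self hM, hv, ip_zero_right]

/-- The projection of `Aⁿ` onto the image of `M`, as a map to this image. -/
noncomputable def toProjImage (hM : IsStarProjection M) (a : std A n) :
    (std A n).ofClosedSubmodule (projImage M hM) :=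
  (⟨matrixAct M a, a, rfl⟩ : LinearMap.range (matrixAct M))

theorem toProjImage_inclusion (hM : IsStarProjection M)
    (v : (std A n).ofClosedSubmodule (projImage M hM)) :
    toProjImage hM ((std A n).inclusion _ v) = v :=
  Subtype.ext ((mem_projImage hM).1 v.2)

theorem isAdjoint_inclusion (hM : IsStarProjection M) :
    IsAdjoint ((std A n).inclusion (projImage M hM)) (toProjImage hM) := fun v a => by
  have hv : matrixAct M ((std A n).inclusion _ v) = (std A n).inclusion _ v :=
    (mem_projImage hM).1 v.2
  rw [← hv]
  exact isAdjoint_matrixAct_self hM _ a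

/-- The decomposition of `Aⁿ` as the direct sum of the images of `M` and of `1 - M`. -/
noncomputable def sumIso (hM : IsStarProjection M) :
    IsometricIso (((std A n).ofClosedSubmodule (projImage M hM)).prod
      ((std A n).ofClosedSubmodule (projImage (1 - M) hM.one_sub))) (std A n) :=
  have hadjoint : IsAdjoint
      (fun z => (std A n).inclusion (projImage M hM) (prodFst _ _ z) +
        (std A n).inclusion (projImage (1 - M) hM.one_sub) (prodSnd _ _ z))
      (fun a => prodMk _ _ (toProjImage hM a) (toProjImage hM.one_sub a)) := fun z a => by
    rw [ip_add_left, isAdjoint_inclusion hM, isAdjoint_inclusion hM.one_sub]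
    rfl
  hadjoint.isometricIso
    (fun z => by
      have hfst : matrixAct M ((std A n).inclusion _ (prodFst _ _ z)) = _ :=
        (mem_projImage hM).1 (prodFst _ _ z).2
      have hsnd : matrixAct M ((std A n).inclusion _ (prodSnd _ _ z)) = 0 :=
        (mem_projImage_one_sub hM).1 (prodSnd _ _ z).2
      refine congrArg₂ (prodMk _ _) (Subtype.ext ?_) (Subtype.ext ?_)
      · change matrixAct M (_ + _) = _
        rw [map_add, hfst, hsnd, add_zero]
        rfl
      · change matrixAct (1 - M) (_ + _) = _
        rw [matrixAct_one_sub, map_add, hfst, hsnd, add_zero, add_sub_cancel_left]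
        rfl)
    (fun a => by
      change matrixAct M a + matrixAct (1 - M) a = a
      rw [matrixAct_one_sub, add_sub_cancel])

theorem isFGP_projImage (hM : IsStarProjection M) :
    ((std A n).ofClosedSubmodule (projImage M hM)).IsFGP := ⟨n, _, ⟨sumIso hM⟩⟩

end HilbertModule

namespace ProjectionFunction

open HilbertModule HilbertModuleFamily

variable {A : Type u} [CStarAlgebra A] [PartialOrder A] [StarOrderedRing A] {X : Type v}
  [TopologicalSpace X] {n : ℕ} (ε : ProjectionFunction A X n)

/-- The inclusion of the image of `ε` in `X × Aⁿ` as a frame. -/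
noncomputable def naturalFrame : ε.image.ParsevalFrame n where
  analysis := ε.incl
  synthesis := ε.toImage
  isAdjoint x := isAdjoint_inclusion (ε.isStarProjection x)
  synthesis_analysis x := toProjImage_inclusion (ε.isStarProjection x)
  continuous_analysis :=
    have hincl : Continuous fun q : ε.image.Total =>
      (⟨q.base, ε.incl q.base q.vec⟩ : (ambient A X n).Total) := continuous_induced_dom
    have hambient : Continuous fun q : (ambient A X n).Total => ((q.base, q.vec) : X × std A n) :=
      continuous_induced_dom
    hambient.comp hincl
  continuous_synthesis := continuous_induced_rng.2 (continuous_induced_rng.2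
    (continuous_fst.prodMk (continuous_matrixAct_uncurry.comp
      ((ε.continuous_toFun.comp continuous_fst).prodMk continuous_snd))))

theorem gramMatrix_naturalFrame : ε.naturalFrame.gramMatrix = ε.toFun :=
  funext fun x => toMatrix_matrixAct (ε.toFun x)

theorem isFGPBundle_image : ε.image.IsFGPBundle :=
  ⟨ε.naturalFrame.isBundle, fun x => isFGP_projImage (ε.isStarProjection x)⟩

/-- The complementary projection valued function `1 - ε`. -/
noncomputable def compl : ProjectionFunction A X n where
  toFun x := 1 - ε.toFun x
  continuous_toFun := continuous_const.sub ε.continuous_toFun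
  isStarProjection x := (ε.isStarProjection x).one_sub

/-- The decomposition of `X × Aⁿ` as the direct sum of the images of `ε` and of `1 - ε`. -/
noncomputable def sumIso :
    HilbertModuleFamily.Iso (ε.image.directSum ε.compl.image) (ambient A X n) where
  fiberEquiv x := (HilbertModule.sumIso (ε.isStarProjection x)).toLinearEquiv
  adjointable x := ⟨_, (HilbertModule.sumIso (ε.isStarProjection x)).isAdjoint⟩
  continuous_toFun := by
    have hsummands : Continuous fun q : (ε.image.directSum ε.compl.image).Total =>
        ((⟨q.base, prodFst _ _ q.vec⟩, ⟨q.base, prodSnd _ _ q.vec⟩) :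
          ε.image.Total × ε.compl.image.Total) := continuous_induced_dom
    have hfst := ε.naturalFrame.continuous_analysis.comp (continuous_fst.comp hsummands)
    have hsnd := ε.compl.naturalFrame.continuous_analysis.comp (continuous_snd.comp hsummands)
    exact continuous_induced_rng.2 ((continuous_fst.comp hfst).prodMk
      ((continuous_snd.comp hfst).add (continuous_snd.comp hsnd)))
  continuous_invFun := by
    have hambient : Continuous fun q : (ambient A X n).Total => ((q.base, q.vec) : X × std A n) :=
      continuous_induced_dom
    exact continuous_induced_rng.2 ((ε.naturalFrame.continuous_synthesis.comp hambient).prodMk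
      (ε.compl.naturalFrame.continuous_synthesis.comp hambient))

theorem isOrthogonalSummand : (ambient A X n).IsOrthogonalSummand
    fun x => projImage (ε.toFun x) (ε.isStarProjection x) := by
  have hcomplement : ∀ p,
      p = (fun x => projImage (ε.compl.toFun x) (ε.compl.isStarProjection x)) →
      ((ambient A X n).sub p).IsFGPBundle ∧
        ∃ Ψ : HilbertModuleFamily.Iso (ε.image.directSum ((ambient A X n).sub p)) (ambient A X n),
          Ψ.IsIsometric ∧ ∀ x v w, Ψ.fiberEquiv x (prodMk _ _ v w) =
            (std A n).inclusion _ v + (std A n).inclusion _ w := by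
    rintro _ rfl
    exact ⟨ε.compl.isFGPBundle_image, ε.sumIso,
      fun x => (HilbertModule.sumIso (ε.isStarProjection x)).ip_map, fun _ _ _ => rfl⟩
  exact ⟨ε.isFGPBundle_image,
    hcomplement _ (funext fun x => orthogonal_projImage (ε.isStarProjection x))⟩

section Smooth

variable {E : Type*} [NormedAddCommGroup E] [NormedSpace ℝ E] {H : Type*} [TopologicalSpace H]
  {I : ModelWithCorners ℝ E H} [ChartedSpace H X]

theorem exists_isInherited
    (h : ContMDiff I 𝓘(ℝ, CStarMatrix (Fin n) (Fin n) A) ∞ ε.toFun) :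
    ∃ S : ε.image.SmoothStructure I, ε.IsInherited S :=
  ⟨_, ParsevalFrame.isSmooth_smoothStructure (F := ε.naturalFrame)
    (ε.gramMatrix_naturalFrame ▸ h)⟩

variable {ε} {S S' : ε.image.SmoothStructure I}

theorem IsInherited.isSmoothMap_id (h : ε.IsInherited S) (h' : ε.IsInherited S') :
    IsSmoothMap S S' fun _ v => v := by
  have hid : (fun x v => ε.toImage x (ε.incl x v)) = fun _ v => v :=
    funext fun x => funext (ε.naturalFrame.synthesis_analysis x)
  exact hid ▸ h'.2.comp h.1

theorem IsInherited.equivalent (h : ε.IsInherited S) (h' : ε.IsInherited S') :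
    S.Equivalent S' := ⟨h.isSmoothMap_id h', h'.isSmoothMap_id h⟩

end Smooth

end ProjectionFunction

namespace HilbertModuleFamily

open HilbertModule

variable {A : Type u} [CStarAlgebra A] [PartialOrder A] [StarOrderedRing A] {X : Type v}
  [TopologicalSpace X] {n : ℕ}

namespace ParsevalFrame

section LinearMapMatrix

variable {W : HilbertModuleFamily.{u, v, w} A X} {W₁ : HilbertModuleFamily.{u, v, w₁} A X}
  {W₂ : HilbertModuleFamily.{u, v, w₂} A X} {W₃ : HilbertModuleFamily.{u, v, w₃} A X}
  (F : W.ParsevalFrame n) (F₁ : W₁.ParsevalFrame n) (F₂ : W₂.ParsevalFrame n)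
  (F₃ : W₃.ParsevalFrame n) {x y z : X}

/-- The matrix of a linear map between fibers with respect to two frames. -/
noncomputable def linearMapMatrix (L : W₁.fiber x →ₗ[Aᵐᵒᵖ] W₂.fiber y) :
    CStarMatrix (Fin n) (Fin n) A :=
  toMatrix (F₂.analysis y ∘ L ∘ F₁.synthesis x)

theorem matrixAct_linearMapMatrix (L : W₁.fiber x →ₗ[Aᵐᵒᵖ] W₂.fiber y) (a : std A n) :
    matrixAct (F₁.linearMapMatrix F₂ L) a = F₂.analysis y (L (F₁.synthesis x a)) :=
  matrixAct_toMatrix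
    ((F₂.isAdjoint y).toLinearMap ∘ₗ L ∘ₗ (F₁.isAdjoint x).symm.toLinearMap) a

theorem linearMapMatrix_id : F.linearMapMatrix F (LinearMap.id : W.fiber x →ₗ[Aᵐᵒᵖ] W.fiber x) =
    F.gramMatrix x := rfl

theorem linearMapMatrix_mul (L' : W₂.fiber y →ₗ[Aᵐᵒᵖ] W₃.fiber z)
    (L : W₁.fiber x →ₗ[Aᵐᵒᵖ] W₂.fiber y) :
    F₂.linearMapMatrix F₃ L' * F₁.linearMapMatrix F₂ L = F₁.linearMapMatrix F₃ (L' ∘ₗ L) :=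
  matrix_ext fun a => by
    rw [matrixAct_mul, matrixAct_linearMapMatrix, matrixAct_linearMapMatrix,
      matrixAct_linearMapMatrix, synthesis_analysis, LinearMap.comp_apply]

theorem isInverseBetween_linearMapMatrix (L : W₁.fiber x ≃ₗ[Aᵐᵒᵖ] W₂.fiber y) :
    IsInverseBetween (F₁.linearMapMatrix F₂ L.toLinearMap)
      (F₂.linearMapMatrix F₁ L.symm.toLinearMap) (F₁.gramMatrix x) (F₂.gramMatrix y) where
  mul_initial := by rw [← linearMapMatrix_id, linearMapMatrix_mul, LinearMap.comp_id]
  inv_mul_final := by rw [← linearMapMatrix_id, linearMapMatrix_mul, LinearMap.comp_id]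
  inv_mul_self := by rw [linearMapMatrix_mul, LinearEquiv.symm_comp, linearMapMatrix_id]
  mul_inv_self := by rw [linearMapMatrix_mul, LinearEquiv.comp_symm, linearMapMatrix_id]

theorem continuous_linearMapMatrix (Φ : Iso W₁ W₂) :
    Continuous fun x => F₁.linearMapMatrix F₂ (Φ.fiberEquiv x).toLinearMap :=
  continuous_toMatrix fun _ => continuous_snd.comp (F₂.continuous_analysis.comp
    (Φ.continuous_toFun.comp (F₁.continuous_synthesis.comp
      (continuous_id.prodMk continuous_const))))

theorem exists_continuous_isPartialIsometryBetween (Φ : Iso W₁ W₂) :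
    ∃ U : X → CStarMatrix (Fin n) (Fin n) A, Continuous U ∧
      ∀ x, IsPartialIsometryBetween (U x) (F₁.gramMatrix x) (F₂.gramMatrix x) :=
  have hinverse x := F₁.isInverseBetween_linearMapMatrix F₂ (Φ.fiberEquiv x)
  have hproj x := And.intro (F₁.isStarProjection_gramMatrix x) (F₂.isStarProjection_gramMatrix x)
  ⟨fun x => polar (F₁.linearMapMatrix F₂ (Φ.fiberEquiv x).toLinearMap) (F₁.gramMatrix x),
    continuous_polar (F₁.continuous_linearMapMatrix F₂ Φ) F₁.continuous_gramMatrix fun x =>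
      ⟨(hproj x).1, (hinverse x).isUnit_absSq (hproj x).1 (hproj x).2⟩,
    fun x => ((hinverse x).isInvertibleBetween (hproj x).1 (hproj x).2).polar
      (hproj x).1 (hproj x).2⟩

end LinearMapMatrix

variable {W : HilbertModuleFamily.{u, v, w} A X}

theorem exists_isometric_iso_image (F : W.ParsevalFrame n) :
    ∃ Φ : Iso W F.gram.image, Φ.IsIsometric :=
  exists_isometric_iso_of_norm_sub_lt (F₁ := F) (F₂ := F.gram.naturalFrame) fun x => by
    rw [F.gram.gramMatrix_naturalFrame, gram, sub_self, norm_zero]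
    exact one_pos

variable {E : Type*} [NormedAddCommGroup E] [NormedSpace ℝ E] {H : Type*} [TopologicalSpace H]
  {I : ModelWithCorners ℝ E H} [ChartedSpace H X]

theorem IsSmooth.exists_isometric_isSmooth_iso_image {F : W.ParsevalFrame n}
    {S : W.SmoothStructure I} (hF : F.IsSmooth S) {S' : F.gram.image.SmoothStructure I}
    (hS' : F.gram.IsInherited S') :
    ∃ Φ : Iso W F.gram.image, Φ.IsIsometric ∧ Φ.IsSmooth S S' :=
  hF.exists_isometric_isSmooth_iso_of_norm_sub_lt (F₂ := F.gram.naturalFrame) hS' fun x => by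
    rw [F.gram.gramMatrix_naturalFrame, gram, sub_self, norm_zero]
    exact one_pos

theorem nonempty_smoothStructure [FiniteDimensional ℝ E] [IsManifold I ∞ X] [SigmaCompactSpace X]
    [T2Space X] (F : W.ParsevalFrame n) : Nonempty (W.SmoothStructure I) := by
  obtain ⟨p, hp, hproj, hclose⟩ := exists_contMDiff_isStarProjection (I := I)
    F.continuous_gramMatrix F.isStarProjection_gramMatrix one_pos
  let ε : ProjectionFunction A X n := ⟨p, hp.continuous, hproj⟩
  obtain ⟨Φ, hΦ⟩ := exists_isometric_iso_of_norm_sub_lt (F₁ := F) (F₂ := ε.naturalFrame) fun x => by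
    rw [ε.gramMatrix_naturalFrame, norm_sub_rev]
    exact hclose x
  refine ⟨(ε.naturalFrame.pullback hΦ).smoothStructure ?_⟩
  rwa [gramMatrix_pullback, ε.gramMatrix_naturalFrame]

end ParsevalFrame

theorem exists_isometric_isSmooth_iso {E : Type*} [NormedAddCommGroup E] [NormedSpace ℝ E]
    [FiniteDimensional ℝ E] {H : Type*} [TopologicalSpace H] {I : ModelWithCorners ℝ E H}
    [ChartedSpace H X] [IsManifold I ∞ X] [CompactSpace X] [T2Space X]
    {W₁ : HilbertModuleFamily.{u, v, w₁} A X} {W₂ : HilbertModuleFamily.{u, v, w₂} A X}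
    (hW₁ : W₁.IsFGPBundle) (hW₂ : W₂.IsFGPBundle) (S₁ : W₁.SmoothStructure I)
    (S₂ : W₂.SmoothStructure I) (Φ : Iso W₁ W₂) :
    ∃ Ψ : Iso W₁ W₂, Ψ.IsIsometric ∧ Ψ.IsSmooth S₁ S₂ := by
  obtain ⟨N, ⟨F₁, hF₁⟩, F₂, hF₂⟩ := ((hW₁.eventually_exists_isSmooth_parsevalFrame S₁).and
    (hW₂.eventually_exists_isSmooth_parsevalFrame S₂)).exists
  obtain ⟨U, hU, hpartial⟩ := F₁.exists_continuous_isPartialIsometryBetween F₂ Φ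
  obtain ⟨V, hV, hpartial⟩ := exists_contMDiff_isPartialIsometryBetween hU
    hF₁.contMDiff_gramMatrix hF₂.contMDiff_gramMatrix
    (fun x => ⟨F₁.isStarProjection_gramMatrix x, F₂.isStarProjection_gramMatrix x⟩) hpartial
  exact ⟨F₁.iso F₂ hV.continuous hpartial, F₁.isIsometric_iso F₂ hV.continuous hpartial,
    hF₁.isSmooth_iso hF₂ hV hpartial⟩

end HilbertModuleFamily

theorem ProjectionFunction.exists_isometric_iso_of_norm_sub_lt {A : Type u} [CStarAlgebra A]
    [PartialOrder A] [StarOrderedRing A] {X : Type v} [TopologicalSpace X] {n : ℕ}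
    {ε₁ ε₂ : ProjectionFunction A X n} (h : ∀ x, ‖ε₁.toFun x - ε₂.toFun x‖ < 1) :
    ∃ Φ : HilbertModuleFamily.Iso ε₁.image ε₂.image, Φ.IsIsometric :=
  HilbertModuleFamily.ParsevalFrame.exists_isometric_iso_of_norm_sub_lt
    (F₁ := ε₁.naturalFrame) (F₂ := ε₂.naturalFrame) fun x => by
      rw [ε₁.gramMatrix_naturalFrame, ε₂.gramMatrix_naturalFrame]
      exact h x

theorem mainTheorem10 {A : Type u} [CStarAlgebra A] [PartialOrder A] [StarOrderedRing A]
    {X : Type v} [TopologicalSpace X] [CompactSpace X] [T2Space X] :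
    -- W is isometrically an orthogonal direct summand of a trivial bundle
    (∀ W : HilbertModuleFamily.{u, v, w} A X, W.IsFGPBundle →
      ∃ (n : ℕ) (p : X → ClosedSubmodule Aᵐᵒᵖ (HilbertModule.std A n)),
        (HilbertModuleFamily.trivial X (HilbertModule.std A n)).IsOrthogonalSummand p ∧
        ∃ Φ : HilbertModuleFamily.Iso W
            ((HilbertModuleFamily.trivial X (HilbertModule.std A n)).sub p), Φ.IsIsometric) ∧
    -- W is isometrically the image of a projection valued function
    (∀ W : HilbertModuleFamily.{u, v, w} A X, W.IsFGPBundle →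
      ∃ (n : ℕ) (ε : ProjectionFunction A X n),
        ∃ Φ : HilbertModuleFamily.Iso W ε.image, Φ.IsIsometric) ∧
    -- images of projection valued functions are bundles
    (∀ (n : ℕ) (ε : ProjectionFunction A X n), ε.image.IsFGPBundle) ∧
    -- nearby projection valued functions have isomorphic images
    (∀ (n : ℕ) (ε₁ : ProjectionFunction A X n), ∃ δ : ℝ, 0 < δ ∧
      ∀ ε₂ : ProjectionFunction A X n, (∀ x, ‖ε₁.toFun x - ε₂.toFun x‖ < δ) →
        ∃ Φ : HilbertModuleFamily.Iso ε₁.image ε₂.image, Φ.IsIsometric) ∧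
    -- the smooth statements, if X is a smooth manifold
    (∀ {E : Type uE} [NormedAddCommGroup E] [NormedSpace ℝ E] [FiniteDimensional ℝ E]
      {H : Type uH} [TopologicalSpace H] (I : ModelWithCorners ℝ E H) [ChartedSpace H X]
      [IsManifold I ∞ X],
      -- the image of a smooth projection valued function has a canonical smooth structure
      (∀ (n : ℕ) (ε : ProjectionFunction A X n),
        ContMDiff I 𝓘(ℝ, CStarMatrix (Fin n) (Fin n) A) ∞ ε.toFun →
        ∃ S : ε.image.SmoothStructure I, ε.IsInherited S ∧
          ∀ S' : ε.image.SmoothStructure I, ε.IsInherited S' → S'.Equivalent S) ∧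
      -- a smooth bundle is smoothly isomorphic to the image of a smooth projection valued function
      (∀ (W : HilbertModuleFamily.{u, v, w} A X) (S : W.SmoothStructure I), W.IsFGPBundle →
        ∃ (n : ℕ) (ε : ProjectionFunction A X n),
          ContMDiff I 𝓘(ℝ, CStarMatrix (Fin n) (Fin n) A) ∞ ε.toFun ∧
          ∃ S' : ε.image.SmoothStructure I, ε.IsInherited S' ∧
            ∃ Φ : HilbertModuleFamily.Iso W ε.image, Φ.IsIsometric ∧ Φ.IsSmooth S S') ∧
      -- existence of smooth structures
      (∀ W : HilbertModuleFamily.{u, v, w} A X, W.IsFGPBundle →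
        Nonempty (W.SmoothStructure I)) ∧
      -- uniqueness: topologically isomorphic smooth bundles are smoothly isomorphic
      (∀ (W₁ : HilbertModuleFamily.{u, v, w} A X) (W₂ : HilbertModuleFamily.{u, v, w'} A X)
        (S₁ : W₁.SmoothStructure I) (S₂ : W₂.SmoothStructure I),
        W₁.IsFGPBundle → W₂.IsFGPBundle → Nonempty (HilbertModuleFamily.Iso W₁ W₂) →
        ∃ Φ : HilbertModuleFamily.Iso W₁ W₂, Φ.IsIsometric ∧ Φ.IsSmooth S₁ S₂)) := by
  refine ⟨fun W hW => ?_, fun W hW => ?_, fun n ε => ε.isFGPBundle_image, fun n ε₁ => ?_,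
    fun I _ _ => ⟨fun n ε hε => ?_, fun W S hW => ?_, fun W hW => ?_,
      fun W₁ W₂ S₁ S₂ hW₁ hW₂ ⟨Φ⟩ =>
        HilbertModuleFamily.exists_isometric_isSmooth_iso hW₁ hW₂ S₁ S₂ Φ⟩⟩
  · obtain ⟨N, ⟨F⟩⟩ := hW.eventually_exists_parsevalFrame.exists
    exact ⟨N, _, F.gram.isOrthogonalSummand, F.exists_isometric_iso_image⟩
  · obtain ⟨N, ⟨F⟩⟩ := hW.eventually_exists_parsevalFrame.exists
    exact ⟨N, F.gram, F.exists_isometric_iso_image⟩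
  · exact ⟨1, one_pos, fun ε₂ h => ProjectionFunction.exists_isometric_iso_of_norm_sub_lt h⟩
  · obtain ⟨S, hS⟩ := ε.exists_isInherited hε
    exact ⟨S, hS, fun S' hS' => hS'.equivalent hS⟩
  · obtain ⟨N, F, hF⟩ := (hW.eventually_exists_isSmooth_parsevalFrame S).exists
    obtain ⟨S', hS'⟩ := F.gram.exists_isInherited hF.contMDiff_gramMatrix
    exact ⟨N, F.gram, hF.contMDiff_gramMatrix, S', hS',
      hF.exists_isometric_isSmooth_iso_image hS'⟩
  · obtain ⟨N, ⟨F⟩⟩ := hW.eventually_exists_parsevalFrame.exists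
    exact F.nonempty_smoothStructure
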